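/- Throughout, $d,n\ge 1$, $\eta\in(0,1)$, $\mu>0$, $\lambda\ge 0$, $\beta\in\mathbb R^d$, $\Sigma\in\mathbb R^{d\times d}$ is positive semidefinite, $\|\cdot\|$ is the Euclidean norm of vectors and the operator norm of matrices, and $\lambda_{\min}$ is the smallest eigenvalue. Put $R^2=\operatorname{Tr}\Sigma+d\log(n/\eta)$, $R>0$. A data set is $D=((A_i,y_i))_{i\le n}\in(\mathbb R^d\times\mathbb R)^n$; let $\bar A_i,\bar y_i$ be the radial truncations of $A_i,y_i$ to norm at most $R$ and $R\|\beta\|$ respectively. Define $$\hat\beta(D)=\Big(\tfrac1n\sum_i A_iA_i^T+\lambda I\Big)^{-1}\tfrac1n\sum_i y_iA_i,\qquad \hat\beta_{DP}(D)=\Big(\tfrac1n\sum_i\bar A_i\bar A_i^T+\lambda I+G\Big)^{-1}\Big(\tfrac1n\sum_i\bar y_i\bar A_i+g\Big),$$ where $G$ is a random symmetric matrix whose entries on and above the diagonal are independent $N(0,\sigma_1^2)$, $\sigma_1=\frac{2R^2}{\mu n}$, and, independently, $g\sim N(0,\sigma_2^2I)$, $\sigma_2=\frac{2R^2\|\beta\|}{\mu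 n}$. (i) Privacy. $D\mapsto\hat\beta_{DP}(D)$ is $\sqrt2\mu$-Gaussian differentially private: for any two data sets that differ in at most one sample, every test of level $\alpha\in[0,1]$ of the output law on the first against the output law on the second has power at most $1-\Phi(\Phi^{-1}(1-\alpha)-\sqrt2\mu)$, where $\Phi$ is the standard normal distribution function. (ii) Accuracy. For every $K>0$ there are $c,c'>0$ such that for all $\kappa,\rho\ge0$ there is $C>0$ with the following property, for all parameters as above and all $\sigma\ge 0$. Let $y_i=\langle A_i,\beta\rangle+\epsilon_i$, where $A_1,\dots,A_n$ are i.i.d. with $E[A_1A_1^T]=\Sigma$ and are sub-Gaussian with constant $K$ (the $\psi_2$-norm of $\langle u,A_1\rangle$ is at most $K(u^T\Sigma u)^{1/2}$ for all $u$), and $\epsilon\sim N(0,\sigma^2I_n)$ is independent of them; $(G,g)$ is independent of the data. Write $$s=1-c\Big(\sqrt{\tfrac dn}+\sqrt{\tfrac{\log(1/\eta)}n}\Big),\qquad \tau=\frac{\sqrt{d^3\log(2d/\eta)}}{\mu n}\Big(\frac{\operatorname{Tr}\Sigma}d+\log\frac n\eta\Big).$$ Assume that with probability at least $1-\eta$ one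 has $\|A_i\|\le R$ and $|y_i|\le R\|\beta\|$ for all $i$; that $\lambda\le\kappa\|\Sigma\|$ and $\sigma\sqrt{(d+\log(1/\eta))/n}\le\rho\,\|\Sigma\|^{1/2}\|\beta\|$; and that $n$ is so large that $s\ge0$ and $\tau\le\frac1{4\sqrt2}\big(\lambda_{\min}(\Sigma)s^2+\lambda\big)$. Then, with probability at least $1-c'\eta$, $$\|\hat\beta_{DP}-\hat\beta\|\le C\,\frac{\tau\,\|\Sigma\|\,\|\beta\|}{\lambda_{\min}(\Sigma)^2s^4+\lambda^2}.$$ -/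

import Mathlib

open MeasureTheory ProbabilityTheory

noncomputable section

namespace DPRidge

/-! ### Gaussian differential privacy -/

/-- Two data sets of `n` samples are neighbours if they agree except possibly at one sample. -/
def Neighbours {X : Type*} {n : ℕ} (D D' : Fin n → X) : Prop :=
  ∃ i, ∀ j, j ≠ i → D j = D' j

/-- `f`-differential privacy of a randomized algorithm, given by the law `M D` of its output on
the data set `D`: for neighbouring `D`, `D'`, every (randomized) test `φ` of `H₀ : M D` against
`H₁ : M D'` with level `α` has power at most `1 - f α`. -/
def IsFDP {X S : Type*} [MeasurableSpace S] {n : ℕ} (f : ℝ → ℝ)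
    (M : (Fin n → X) → Measure S) : Prop :=
  (∀ D, IsProbabilityMeasure (M D)) ∧
  ∀ D D', Neighbours D D' → ∀ α ∈ Set.Icc (0 : ℝ) 1, ∀ φ : S → ℝ, Measurable φ →
    (∀ s, φ s ∈ Set.Icc (0 : ℝ) 1) → ∫ s, φ s ∂(M D) ≤ α → ∫ s, φ s ∂(M D') ≤ 1 - f α

/-- The cumulative distribution function `Φ` of the standard normal distribution. -/
def stdNormalCdf (t : ℝ) : ℝ := cdf (gaussianReal 0 1) t

/-- The inverse `Φ⁻¹` of `Φ`, for arguments in `(0, 1)`. -/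
def stdNormalQuantile (p : ℝ) : ℝ := sInf {t : ℝ | p ≤ stdNormalCdf t}

/-- `α ↦ Φ (Φ⁻¹ (1 - α) - μ)` on `[0, 1]`, where `Φ⁻¹ 1 = ∞` and `Φ⁻¹ 0 = -∞`. -/
def gaussianTradeoff (μ α : ℝ) : ℝ :=
  if α ≤ 0 then 1 else if 1 ≤ α then 0
  else stdNormalCdf (stdNormalQuantile (1 - α) - μ)

/-- `μ`-Gaussian differential privacy. (Being `f`-DP for some `f` that is at least
`gaussianTradeoff μ` on `[0, 1]` is the same as being `gaussianTradeoff μ`-DP.) -/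
def IsGDP {X S : Type*} [MeasurableSpace S] {n : ℕ} (μ : ℝ)
    (M : (Fin n → X) → Measure S) : Prop :=
  IsFDP (gaussianTradeoff μ) M

/-! ### Linear algebra and the ridge estimators -/

/-- The operator norm of a matrix with respect to the Euclidean norm. -/
def opNorm {d : ℕ} (M : Matrix (Fin d) (Fin d) ℝ) : ℝ :=
  ‖Matrix.toEuclideanCLM (n := Fin d) (𝕜 := ℝ) M‖

/-- The smallest eigenvalue of a symmetric matrix. -/
def lambdaMin {d : ℕ} (M : Matrix (Fin d) (Fin d) ℝ) : ℝ := sInf (spectrum ℝ M)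

/-- Radial truncation to the closed ball of radius `R`. -/
def truncate {E : Type*} [NormedAddCommGroup E] [NormedSpace ℝ E] (R : ℝ) (x : E) : E :=
  if ‖x‖ ≤ R then x else (R / ‖x‖) • x

/-- `Aᵀ A / n`, where the rows of `A` are the covariates of the data set. -/
def sampleSecondMoment {d n : ℕ} (D : Fin n → EuclideanSpace ℝ (Fin d) × ℝ) :
    Matrix (Fin d) (Fin d) ℝ :=
  Matrix.of fun j k => (∑ i, (D i).1 j * (D i).1 k) / n

/-- `Aᵀ y / n`, where `y` is the vector of the responses of the data set. -/
def sampleCrossMoment {d n : ℕ} (D : Fin n → EuclideanSpace ℝ (Fin d) × ℝ) : Fin d → ℝ :=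
  fun j => (∑ i, (D i).1 j * (D i).2) / n

/-- `(Aᵀ A / n + lam I + G)⁻¹ (Aᵀ y / n + g)`. -/
def noisyRidge {d n : ℕ} (lam : ℝ) (D : Fin n → EuclideanSpace ℝ (Fin d) × ℝ)
    (G : Matrix (Fin d) (Fin d) ℝ) (g : Fin d → ℝ) : EuclideanSpace ℝ (Fin d) :=
  WithLp.toLp 2 (Matrix.mulVec (sampleSecondMoment D + lam • (1 : Matrix (Fin d) (Fin d) ℝ) + G)⁻¹
    (sampleCrossMoment D + g))

/-- The ridge estimator `(Aᵀ A / n + lam I)⁻¹ (Aᵀ y / n)`. -/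
def ridge {d n : ℕ} (lam : ℝ) (D : Fin n → EuclideanSpace ℝ (Fin d) × ℝ) :
    EuclideanSpace ℝ (Fin d) :=
  WithLp.toLp 2 (Matrix.mulVec (sampleSecondMoment D + lam • (1 : Matrix (Fin d) (Fin d) ℝ))⁻¹
    (sampleCrossMoment D))

/-! ### The private ridge regression -/

/-- The truncation radius `√(Tr S + d log (n / η))` of the covariates. -/
def radius {d : ℕ} (n : ℕ) (S : Matrix (Fin d) (Fin d) ℝ) (η : ℝ) : ℝ :=
  √(S.trace + d * Real.log (n / η))

/-- Covariates are truncated at `radius n S η` and responses at `radius n S η * ‖β‖`. -/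
def truncateData {d n : ℕ} (S : Matrix (Fin d) (Fin d) ℝ) (β : EuclideanSpace ℝ (Fin d)) (η : ℝ)
    (D : Fin n → EuclideanSpace ℝ (Fin d) × ℝ) : Fin n → EuclideanSpace ℝ (Fin d) × ℝ :=
  fun i => (truncate (radius n S η) (D i).1, truncate (radius n S η * ‖β‖) (D i).2)

/-- The noise level of the second-moment matrix. -/
def sigma₁ {d : ℕ} (n : ℕ) (S : Matrix (Fin d) (Fin d) ℝ) (η μ : ℝ) : ℝ :=
  2 * (S.trace + d * Real.log (n / η)) / (μ * n)

/-- The noise level of the cross moment. -/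
def sigma₂ {d : ℕ} (n : ℕ) (S : Matrix (Fin d) (Fin d) ℝ) (β : EuclideanSpace ℝ (Fin d))
    (η μ : ℝ) : ℝ :=
  2 * (S.trace + d * Real.log (n / η)) * ‖β‖ / (μ * n)

/-- The law `N(0, σ² I)` of a vector with independent `N(0, σ²)` entries. -/
def gaussianVector (m : ℕ) (σ : ℝ) : Measure (Fin m → ℝ) :=
  Measure.pi fun _ => gaussianReal 0 (σ ^ 2).toNNReal

/-- The law `SG_d(σ²)` of a symmetric `d × d` matrix whose entries on and above the diagonal are
independent `N(0, σ²)` variables. The matrix is given as a function of two indices; there is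
one independent variable for each unordered pair `s(i, j)` of indices. -/
def symGaussian (d : ℕ) (σ : ℝ) : Measure (Fin d → Fin d → ℝ) :=
  (Measure.pi fun _ : Sym2 (Fin d) => gaussianReal 0 (σ ^ 2).toNNReal).map
    fun w i j => w s(i, j)

/-- The joint law of the independent privacy noises `G ~ SG_d(σ₁²)` and `g ~ N(0, σ₂² I)`. -/
def privacyNoise {d : ℕ} (n : ℕ) (S : Matrix (Fin d) (Fin d) ℝ) (β : EuclideanSpace ℝ (Fin d))
    (η μ : ℝ) : Measure ((Fin d → Fin d → ℝ) × (Fin d → ℝ)) :=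
  (symGaussian d (sigma₁ n S η μ)).prod (gaussianVector d (sigma₂ n S β η μ))

/-- The output of the private ridge regression on the data set `D` for given noise `w = (G, g)`. -/
def dpRidge {d n : ℕ} (S : Matrix (Fin d) (Fin d) ℝ) (β : EuclideanSpace ℝ (Fin d)) (lam η : ℝ)
    (D : Fin n → EuclideanSpace ℝ (Fin d) × ℝ) (w : (Fin d → Fin d → ℝ) × (Fin d → ℝ)) :
    EuclideanSpace ℝ (Fin d) :=
  noisyRidge lam (truncateData S β η D) (Matrix.of w.1) w.2

/-- The law of the output of the private ridge regression on the data set `D`. -/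
def dpRidgeLaw {d n : ℕ} (S : Matrix (Fin d) (Fin d) ℝ) (β : EuclideanSpace ℝ (Fin d))
    (lam η μ : ℝ) (D : Fin n → EuclideanSpace ℝ (Fin d) × ℝ) :
    Measure (EuclideanSpace ℝ (Fin d)) :=
  (privacyNoise n S β η μ).map (dpRidge S β lam η D)

/-! ### The data model -/

/-- `ν` is a sub-Gaussian law `subG(S)` on `ℝ^d` with second-moment matrix `S = E[x xᵀ]` and
sub-Gaussian constant `K`: for all `u`, the `ψ₂`-norm of `⟨u, x⟩` is at most
`K (E ⟨u, x⟩²)^(1/2) = K (uᵀ S u)^(1/2)`, that is, `E exp (⟨u, x⟩² / (K² uᵀ S u)) ≤ 2`.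
(If `uᵀ S u = 0`, then `⟨u, x⟩ = 0` almost surely and the last condition is void.) -/
structure IsSubGaussian {d : ℕ} (ν : Measure (EuclideanSpace ℝ (Fin d)))
    (S : Matrix (Fin d) (Fin d) ℝ) (K : ℝ) : Prop where
  prob : IsProbabilityMeasure ν
  integrable : ∀ i j, Integrable (fun x : EuclideanSpace ℝ (Fin d) => x i * x j) ν
  second_moment : ∀ i j, ∫ x : EuclideanSpace ℝ (Fin d), x i * x j ∂ν = S i j
  psi_two : ∀ u : Fin d → ℝ,
    ∫⁻ x : EuclideanSpace ℝ (Fin d),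
      ENNReal.ofReal (Real.exp ((∑ i, u i * x i) ^ 2 /
        (K ^ 2 * (u ⬝ᵥ Matrix.mulVec S u)))) ∂ν ≤ 2

/-- The joint law of the covariates `A₁, …, Aₙ`, independent with law `ν`, and of the errors
`ε₁, …, εₙ`, independent with law `N(0, σ²)` and independent of the covariates. -/
def modelLaw {d : ℕ} (n : ℕ) (ν : Measure (EuclideanSpace ℝ (Fin d))) (σ : ℝ) :
    Measure ((Fin n → EuclideanSpace ℝ (Fin d)) × (Fin n → ℝ)) :=
  (Measure.pi fun _ => ν).prod (gaussianVector n σ)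

/-- The data set with covariates `Aᵢ` and responses `yᵢ = ⟨Aᵢ, β⟩ + εᵢ`. -/
def dataset {d n : ℕ} (β : EuclideanSpace ℝ (Fin d))
    (z : (Fin n → EuclideanSpace ℝ (Fin d)) × (Fin n → ℝ)) :
    Fin n → EuclideanSpace ℝ (Fin d) × ℝ :=
  fun i => (z.1 i, (∑ j, z.1 i j * β j) + z.2 i)

/-- The factor `1 - c (√(d / n) + √(log (1 / η) / n))`. -/
def shrink (c : ℝ) (d n : ℕ) (η : ℝ) : ℝ :=
  1 - c * (√(d / n) + √(Real.log (1 / η) / n))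

/-- `√(d³ log (2 d / η)) (Tr S / d + log (n / η)) / (μ n)`. -/
def noiseOrder {d : ℕ} (n : ℕ) (S : Matrix (Fin d) (Fin d) ℝ) (η μ : ℝ) : ℝ :=
  √((d : ℝ) ^ 3 * Real.log (2 * d / η)) / (μ * n) * (S.trace / d + Real.log (n / η))

end DPRidge

end

open DPRidge

noncomputable section

/-! ### Products of centred Gaussian laws -/

namespace DPRidge

open scoped NNReal ENNReal

section GaussianProduct

variable {ι : Type*} [Fintype ι]

/-! Privacy. The output depends on the data only through two noisy moments. With covariates
truncated at R and responses at R‖β‖, changing one sample moves the second moment by at most 2R²/n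
in Frobenius norm and the cross moment by at most 2R²‖β‖/n. Both changes can be absorbed into the
noise: the output on D' with noise (G, g) is the output on D with translated noise. Measured in
noise standard deviations, each translation has length at most μ, so together they have length at
most √2 μ. Testing a Gaussian product law against a translate has a log-likelihood ratio that is
affine in one standard normal statistic, and the Neyman–Pearson argument then gives the Gaussian
trade-off (`integral_pi_gaussianReal_map_add_le`).

Accuracy. Let M be the sample second moment plus λI, and suppose that M is coercive with constant m
= λ_min s² + λ. If ‖G‖ ≤ 6m/7, then M + G is coercive with constant m/7. The identity (M + G)⁻¹(b +
g) - M⁻¹b = (M + G)⁻¹(g - G M⁻¹b) bounds the error by (7/m)(‖g‖ + ‖G‖ ‖M⁻¹b‖)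
(`norm_inv_add_mulVec_sub_le`). Here M⁻¹b is the ridge estimator β - λM⁻¹β + M⁻¹(Aᵀε/n), of norm at
most 2‖β‖ plus the contribution of the response errors (`norm_ridge_le`).

The random quantities are controlled by union bounds over a 1/16-net of the ball with at most 33^d
points. Coercivity follows from Bernstein's inequality for whitened covariates
(`IsSubGaussian.exists_sampleSecondMoment_ge`). The privacy noises are handled by Gaussian tails
(`exists_privacyNoise_good`). The response errors are Gaussian given the covariates, and in each net
direction their contribution has variance at most σ²/(nm) (`exists_modelLaw_error_good`). With the
truncation event the failure probability is at most 5η. Finally `rate_le` uses m ≤ (1 + κ)‖Σ‖ to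
trade the factor √(‖Σ‖/m) for ‖Σ‖/m, giving the rate with 1/m², and m² ≥ λ_min² s⁴ + λ². The
estimates need log(1/η) ≥ 40; otherwise the claim is void because c' = e⁴⁰. -/

/-- A linear functional of independent centred Gaussian variables is a centred Gaussian variable. -/
lemma map_sum_mul_pi_gaussianReal (v : ι → ℝ≥0) (a : ι → ℝ) (w : ℝ≥0)
    (hw : (w : ℝ) = ∑ i, a i ^ 2 * v i) :
    (Measure.pi fun i => gaussianReal 0 (v i)).map (fun x => ∑ i, a i * x i) =
      gaussianReal 0 w := by
  have hm : Measurable (fun x : ι → ℝ => ∑ i, a i * x i) := by fun_prop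
  have : IsProbabilityMeasure
      ((Measure.pi fun i => gaussianReal 0 (v i)).map (fun x => ∑ i, a i * x i)) :=
    Measure.isProbabilityMeasure_map hm.aemeasurable
  refine Measure.ext_of_charFun ?_
  ext t
  rw [charFun_apply_real, integral_map hm.aemeasurable (by fun_prop), charFun_gaussianReal]
  have h1 : ∀ x : ι → ℝ, Complex.exp (t * ((∑ i, a i * x i : ℝ) : ℂ) * Complex.I) =
      ∏ i, Complex.exp (((t * a i : ℝ) : ℂ) * (x i : ℂ) * Complex.I) := by
    intro x
    rw [← Complex.exp_sum]
    congr 1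
    push_cast
    rw [Finset.mul_sum, Finset.sum_mul]
    refine Finset.sum_congr rfl fun i _ => ?_
    ring
  simp_rw [h1]
  rw [integral_fintype_prod_eq_prod
    (f := fun i (y : ℝ) => Complex.exp (((t * a i : ℝ) : ℂ) * (y : ℂ) * Complex.I))]
  simp_rw [← charFun_apply_real, charFun_gaussianReal]
  rw [← Complex.exp_sum]
  congr 1
  have hw' : (w : ℂ) = ∑ i, (a i : ℂ) ^ 2 * (v i : ℂ) := by
    have := congrArg (fun r : ℝ => (r : ℂ)) hw
    simpa using this
  rw [hw', Finset.sum_mul, Finset.sum_div]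
  simp only [Complex.ofReal_zero, mul_zero, zero_mul, zero_sub]
  rw [← Finset.sum_neg_distrib]
  refine Finset.sum_congr rfl fun i _ => ?_
  push_cast
  ring

/-- Two-sided Gaussian tail bound. -/
lemma gaussianReal_abs_gt_le (v : ℝ≥0) {r t : ℝ} (hr : 0 ≤ r) (ht : 0 ≤ t)
    (hv : (v : ℝ) ≤ r ^ 2) :
    gaussianReal 0 v {x | r * t < |x|} ≤ ENNReal.ofReal (2 * Real.exp (-t ^ 2 / 2)) := by
  have hsub : HasSubgaussianMGF (fun x : ℝ => x) v (gaussianReal 0 v) := by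
    refine ⟨fun s => integrable_exp_mul_gaussianReal s, fun s => ?_⟩
    rw [mgf_fun_id_gaussianReal]
    simp
  rcases eq_or_lt_of_le hr with h0 | hpos
  · have hv0 : v = 0 := by
      have h2 : (v : ℝ) ≤ 0 := by simpa [← h0] using hv
      exact le_antisymm (by exact_mod_cast h2) bot_le
    subst hv0
    rw [gaussianReal_zero_var, Measure.dirac_apply' _ (measurableSet_lt (by fun_prop) (by fun_prop))]
    simp [← h0]
  have hexp : Real.exp (-(r * t) ^ 2 / (2 * v)) ≤ Real.exp (-t ^ 2 / 2) ∨ v = 0 := by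
    by_cases hv0 : v = 0
    · exact Or.inr hv0
    left
    have hvpos : (0 : ℝ) < v := by
      have : 0 < v := pos_iff_ne_zero.mpr hv0
      exact_mod_cast this
    rw [Real.exp_le_exp, div_le_div_iff₀ (by positivity) (by norm_num)]
    nlinarith [mul_le_mul_of_nonneg_right hv (sq_nonneg t)]
  rcases hexp with hexp | hv0
  swap
  · subst hv0
    rw [gaussianReal_zero_var, Measure.dirac_apply' _ (measurableSet_lt (by fun_prop) (by fun_prop))]
    have : (0 : ℝ) ∉ {x : ℝ | r * t < |x|} := by simp; positivity
    simp only [this, not_false_eq_true, Set.indicator_of_notMem, zero_le]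
  have hrt : 0 ≤ r * t := by positivity
  have h1 := (hsub.measure_ge_le hrt).trans hexp
  have h2 := (hsub.neg.measure_ge_le hrt).trans hexp
  have hset : {x : ℝ | r * t < |x|} ⊆ {x | r * t ≤ x} ∪ {x | r * t ≤ (-fun x : ℝ => x) x} := by
    intro x hx
    rcases lt_abs.1 (show r * t < |x| from hx) with h | h
    · exact Or.inl h.le
    · exact Or.inr h.le
  rw [← ENNReal.ofReal_toReal (measure_ne_top (gaussianReal 0 v) _)]
  refine ENNReal.ofReal_le_ofReal ?_
  change (gaussianReal 0 v).real _ ≤ _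
  calc (gaussianReal 0 v).real {x | r * t < |x|}
      ≤ _ := measureReal_mono hset
    _ ≤ _ := measureReal_union_le _ _
    _ ≤ 2 * Real.exp (-t ^ 2 / 2) := by linarith

/-- Tail bound for a linear functional of independent centred Gaussian variables. -/
lemma pi_gaussianReal_abs_sum_gt_le (v : ι → ℝ≥0) (a : ι → ℝ) {r t : ℝ} (hr : 0 ≤ r) (ht : 0 ≤ t)
    (h : ∑ i, a i ^ 2 * v i ≤ r ^ 2) :
    (Measure.pi fun i => gaussianReal 0 (v i)) {x | r * t < |∑ i, a i * x i|} ≤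
      ENNReal.ofReal (2 * Real.exp (-t ^ 2 / 2)) := by
  have hnn : 0 ≤ ∑ i, a i ^ 2 * (v i : ℝ) := Finset.sum_nonneg fun i _ => by positivity
  have hm := map_sum_mul_pi_gaussianReal v a ⟨_, hnn⟩ rfl
  have h2 := gaussianReal_abs_gt_le ⟨_, hnn⟩ hr ht h
  rw [← hm, Measure.map_apply (by fun_prop)
    (measurableSet_lt (by fun_prop) (by fun_prop))] at h2
  exact h2

/-- Density of a shifted Gaussian law on the line. -/
lemma gaussianReal_eq_withDensity (m : ℝ) (v : ℝ≥0) (hm : v = 0 → m = 0) :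
    gaussianReal m v = (gaussianReal 0 v).withDensity
      (fun x => ENNReal.ofReal (Real.exp (m * x / v - m ^ 2 / (2 * v)))) := by
  by_cases hv : v = 0
  · simp [hv, hm hv]
  have hv' : (v : ℝ) ≠ 0 := by exact_mod_cast hv
  rw [gaussianReal_of_var_ne_zero _ hv, gaussianReal_of_var_ne_zero _ hv,
    ← withDensity_mul _ (measurable_gaussianPDF _ _) (by fun_prop)]
  congr 1
  ext x
  rw [Pi.mul_apply, gaussianPDF, gaussianPDF, ← ENNReal.ofReal_mul (gaussianPDFReal_nonneg _ _ _)]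
  congr 1
  rw [gaussianPDFReal, gaussianPDFReal, mul_assoc _ (Real.exp _) (Real.exp _), ← Real.exp_add]
  congr 2
  field_simp
  ring

/-- Density of a shifted product of Gaussian laws (Cameron–Martin in finite dimension). -/
lemma pi_gaussianReal_map_add (v : ι → ℝ≥0) (m : ι → ℝ) (hm : ∀ i, v i = 0 → m i = 0) :
    (Measure.pi fun i => gaussianReal 0 (v i)).map (fun x => x + m) =
      (Measure.pi fun i => gaussianReal 0 (v i)).withDensity (fun x => ENNReal.ofReal
        (Real.exp ((∑ i, m i / v i * x i) - (∑ i, m i ^ 2 / v i) / 2))) := by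
  have e1 : (Measure.pi fun i => gaussianReal 0 (v i)).map (fun x => x + m) =
      Measure.pi fun i => gaussianReal (m i) (v i) := by
    have := Measure.pi_map_pi (μ := fun i => gaussianReal 0 (v i)) (f := fun i x => x + m i)
      (fun i => by fun_prop)
    simp only [gaussianReal_map_add_const, zero_add] at this
    exact this
  rw [e1]
  -- A product measure is determined by its values on boxes; there the density times the indicator
  -- factors over the coordinates.
  refine Measure.pi_eq fun s hs => ?_
  rw [withDensity_apply _ (MeasurableSet.univ_pi hs), ← lintegral_indicator (MeasurableSet.univ_pi hs)]
  have h2 : ∀ x : ι → ℝ, (Set.univ.pi s).indicator (fun x => ENNReal.ofReal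
        (Real.exp ((∑ i, m i / v i * x i) - (∑ i, m i ^ 2 / v i) / 2))) x =
      ∏ i, (s i).indicator (fun y => ENNReal.ofReal
        (Real.exp (m i * y / v i - m i ^ 2 / (2 * v i)))) (x i) := by
    intro x
    by_cases hx : x ∈ Set.univ.pi s
    · rw [Set.indicator_of_mem hx]
      have : ∀ i, (s i).indicator (fun y => ENNReal.ofReal
        (Real.exp (m i * y / v i - m i ^ 2 / (2 * v i)))) (x i) = ENNReal.ofReal
        (Real.exp (m i * x i / v i - m i ^ 2 / (2 * v i))) :=
        fun i => Set.indicator_of_mem (hx i (Set.mem_univ i)) _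
      simp_rw [this]
      rw [← ENNReal.ofReal_prod_of_nonneg (fun i _ => by positivity), ← Real.exp_sum]
      congr 2
      rw [Finset.sum_sub_distrib, Finset.sum_div]
      congr 1
      · exact Finset.sum_congr rfl fun i _ => by ring
      · exact Finset.sum_congr rfl fun i _ => by rw [div_div, mul_comm (2 : ℝ)]
    · rw [Set.indicator_of_notMem hx]
      simp only [Set.mem_pi, Set.mem_univ, true_implies, not_forall] at hx
      obtain ⟨i, hi⟩ := hx
      exact (Finset.prod_eq_zero (Finset.mem_univ i) (Set.indicator_of_notMem hi _)).symm
  simp_rw [h2]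
  have hmeas : ∀ i, Measurable ((s i).indicator (fun y : ℝ => ENNReal.ofReal
        (Real.exp (m i * y / v i - m i ^ 2 / (2 * v i))))) :=
    fun i => Measurable.indicator (by fun_prop) (hs i)
  have hind : iIndepFun (fun i (x : ι → ℝ) => (s i).indicator (fun y : ℝ => ENNReal.ofReal
        (Real.exp (m i * y / v i - m i ^ 2 / (2 * v i)))) (x i))
        (Measure.pi fun i => gaussianReal 0 (v i)) :=
    iIndepFun_pi (fun i => (hmeas i).aemeasurable)
  rw [lintegral_prod_eq_prod_lintegral_of_indepFun Finset.univ _ hind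
    (fun i => (hmeas i).comp (measurable_pi_apply i))]
  refine Finset.prod_congr rfl fun i _ => ?_
  rw [gaussianReal_eq_withDensity (m i) (v i) (hm i), withDensity_apply _ (hs i),
    ← lintegral_indicator (hs i), ← lintegral_map (hmeas i) (measurable_pi_apply i)]
  congr 1
  have := (measurePreserving_eval (fun i => gaussianReal 0 (v i)) i).map_eq
  exact this

end GaussianProduct

end DPRidge

end

noncomputable section

/-! ### The Neyman–Pearson bound for Gaussian shifts -/

namespace DPRidge

open scoped NNReal ENNReal

lemma stdNormalCdf_mono : Monotone stdNormalCdf := (cdf (gaussianReal 0 1)).mono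

lemma stdNormalCdf_eq_real (t : ℝ) : stdNormalCdf t = (gaussianReal 0 1).real (Set.Iic t) :=
  cdf_eq_real _ t

/-- The normal law has no atoms, so the left limit of its distribution function agrees with its
value; right continuity is automatic. -/
lemma continuous_stdNormalCdf : Continuous stdNormalCdf := by
  have : NullSingletonClass (gaussianReal 0 1) := nullSingletonClass_gaussianReal one_ne_zero
  have h : ∀ t, ContinuousAt stdNormalCdf t := by
    intro t
    have hmono : Monotone (cdf (gaussianReal 0 1)) := (cdf (gaussianReal 0 1)).mono
    have h1 := (cdf (gaussianReal 0 1)).measure_singleton t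
    rw [measure_cdf, measure_singleton] at h1
    have h2 : Function.leftLim (cdf (gaussianReal 0 1)) t = cdf (gaussianReal 0 1) t := by
      have h3 := hmono.leftLim_le (le_refl t)
      have h4 := ENNReal.ofReal_eq_zero.1 h1.symm
      linarith
    have h5 := (hmono.continuousWithinAt_Iio_iff_leftLim_eq (x := t)).2 h2
    have h6 := (cdf (gaussianReal 0 1)).right_continuous t
    exact continuousAt_iff_continuous_left'_right'.2 ⟨h5, h6.mono Set.Ioi_subset_Ici_self⟩
  exact continuous_iff_continuousAt.2 h

/-- By continuity the infimum defining the quantile is attained, and a strict excess there would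
persist slightly to its left, against minimality. -/
lemma stdNormalCdf_stdNormalQuantile {p : ℝ} (h0 : 0 < p) (h1 : p < 1) :
    stdNormalCdf (stdNormalQuantile p) = p := by
  set s := {t : ℝ | p ≤ stdNormalCdf t} with hs
  have hclosed : IsClosed s := isClosed_le continuous_const continuous_stdNormalCdf
  have hlow : ∃ b, stdNormalCdf b < p :=
    ((tendsto_cdf_atBot (gaussianReal 0 1)).eventually (gt_mem_nhds h0)).exists
  have hhigh : ∃ b, p < stdNormalCdf b :=
    ((tendsto_cdf_atTop (gaussianReal 0 1)).eventually (lt_mem_nhds h1)).exists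
  obtain ⟨b, hb⟩ := hlow
  obtain ⟨u, hu⟩ := hhigh
  have hbdd : BddBelow s := ⟨b, fun t ht => by
    by_contra hlt
    have := stdNormalCdf_mono (not_le.1 hlt).le
    have ht' : p ≤ stdNormalCdf t := ht
    linarith⟩
  have hmem : sInf s ∈ s := hclosed.csInf_mem ⟨u, hu.le⟩ hbdd
  refine le_antisymm ?_ hmem
  by_contra hlt
  push Not at hlt
  have hev : ∀ᶠ t in nhds (sInf s), p < stdNormalCdf t :=
    continuous_stdNormalCdf.continuousAt.eventually (lt_mem_nhds hlt)
  obtain ⟨ε, hε, hball⟩ := Metric.eventually_nhds_iff.1 hev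
  have : p < stdNormalCdf (sInf s - ε / 2) := hball (by
    rw [Real.dist_eq]
    rw [abs_lt]; constructor <;> linarith)
  have := csInf_le hbdd (show sInf s - ε / 2 ∈ s from this.le)
  linarith

lemma gaussianTradeoff_antitone {a b : ℝ} (h : a ≤ b) (α : ℝ) :
    gaussianTradeoff b α ≤ gaussianTradeoff a α := by
  unfold gaussianTradeoff
  split_ifs
  · exact le_rfl
  · exact le_rfl
  · exact stdNormalCdf_mono (by linarith)

lemma gaussianTradeoff_zero {α : ℝ} (hα : α ∈ Set.Icc (0 : ℝ) 1) :
    gaussianTradeoff 0 α = 1 - α := by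
  unfold gaussianTradeoff
  split_ifs with h0 h1
  · linarith [hα.1]
  · linarith [hα.2]
  · rw [sub_zero, stdNormalCdf_stdNormalQuantile] <;> linarith [not_le.1 h0, not_le.1 h1]

/-- The tilt is a function of `T`, so it passes to the law of `T`, where it is the density of the
shifted normal law. -/
lemma map_withDensity_exp {Ω : Type*} [MeasurableSpace Ω] (γ : Measure Ω)
    {T : Ω → ℝ} (hT : Measurable T) (hlaw : γ.map T = gaussianReal 0 1) (a : ℝ) :
    (γ.withDensity (fun x => ENNReal.ofReal (Real.exp (a * T x - a ^ 2 / 2)))).map T =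
      gaussianReal a 1 := by
  ext s hs
  rw [Measure.map_apply hT hs, withDensity_apply _ (hT hs),
    gaussianReal_eq_withDensity a 1 (by simp), withDensity_apply _ hs, ← hlaw,
    setLIntegral_map hs (by fun_prop) hT]
  simp

/-- Neyman–Pearson: the likelihood-ratio test is optimal between `γ` and its exponential tilt along
a standard normal statistic. -/
lemma integral_withDensity_exp_le {Ω : Type*} [MeasurableSpace Ω] (γ : Measure Ω)
    [IsProbabilityMeasure γ] {T : Ω → ℝ} (hT : Measurable T) (hlaw : γ.map T = gaussianReal 0 1)
    {a : ℝ} (ha : 0 ≤ a) {φ : Ω → ℝ} (hφ : Measurable φ) (hφ01 : ∀ x, φ x ∈ Set.Icc (0 : ℝ) 1)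
    {α : ℝ} (hα : ∫ x, φ x ∂γ ≤ α) :
    ∫ x, φ x ∂(γ.withDensity (fun x => ENNReal.ofReal (Real.exp (a * T x - a ^ 2 / 2)))) ≤
      1 - gaussianTradeoff a α := by
  set L : Ω → ℝ := fun x => Real.exp (a * T x - a ^ 2 / 2) with hL
  have hLm : Measurable L := by fun_prop
  set γ' := γ.withDensity (fun x => ENNReal.ofReal (L x)) with hγ'
  have hmap : γ'.map T = gaussianReal a 1 := map_withDensity_exp γ hT hlaw a
  have : IsProbabilityMeasure γ' := by
    refine ⟨?_⟩
    rw [← Set.preimage_univ (f := T), ← Measure.map_apply hT MeasurableSet.univ, hmap,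
      measure_univ]
  have hint : ∀ (ρ : Measure Ω) [IsProbabilityMeasure ρ], Integrable φ ρ := fun ρ _ =>
    Integrable.of_bound hφ.aestronglyMeasurable 1 (Filter.Eventually.of_forall fun x => by
      rw [Real.norm_eq_abs, abs_of_nonneg (hφ01 x).1]; exact (hφ01 x).2)
  unfold gaussianTradeoff
  split_ifs with h0 h1
  -- A test of level zero vanishes `γ`-almost everywhere, hence also under the absolutely continuous
  -- tilt.
  · have h2 : ∫ x, φ x ∂γ = 0 :=
      le_antisymm (hα.trans h0) (integral_nonneg fun x => (hφ01 x).1)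
    have h3 := (integral_eq_zero_iff_of_nonneg (fun x => (hφ01 x).1) (hint γ)).1 h2
    have h4 : φ =ᵐ[γ'] 0 := (withDensity_absolutelyContinuous γ _).ae_eq h3
    rw [integral_congr_ae h4]
    simp
  · calc ∫ x, φ x ∂γ' ≤ ∫ x, (1 : ℝ) ∂γ' :=
        integral_mono (hint γ') (integrable_const _) fun x => (hφ01 x).2
      _ = 1 - 0 := by simp
  · push Not at h0 h1
    set t := stdNormalQuantile (1 - α) with ht
    have hcdf : stdNormalCdf t = 1 - α :=
      stdNormalCdf_stdNormalQuantile (by linarith) (by linarith)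
    have hA : MeasurableSet {x | t < T x} := measurableSet_lt measurable_const hT
    have hcompl : {x | t < T x} = (T ⁻¹' Set.Iic t)ᶜ := by
      ext x; simp
    have hsize : γ.real {x | t < T x} = α := by
      rw [hcompl, probReal_compl_eq_one_sub (hT measurableSet_Iic),
        ← map_measureReal_apply hT measurableSet_Iic, hlaw, ← stdNormalCdf_eq_real, hcdf]
      ring
    have hpow : γ'.real {x | t < T x} = 1 - stdNormalCdf (t - a) := by
      rw [hcompl, probReal_compl_eq_one_sub (hT measurableSet_Iic),
        ← map_measureReal_apply hT measurableSet_Iic, hmap, stdNormalCdf_eq_real]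
      have h5 : gaussianReal a 1 = (gaussianReal 0 1).map (fun x => x + a) := by
        rw [gaussianReal_map_add_const, zero_add]
      rw [h5, map_measureReal_apply (by fun_prop) measurableSet_Iic]
      congr 2
      ext x
      simp [le_sub_iff_add_le]
    rw [← hpow]
    have hLint : Integrable L γ := by
      refine ⟨hLm.aestronglyMeasurable, ?_⟩
      rw [hasFiniteIntegral_iff_ofReal (Filter.Eventually.of_forall fun x => (Real.exp_pos _).le)]
      have h6 := measure_lt_top γ' Set.univ
      rwa [hγ', withDensity_apply _ MeasurableSet.univ, Measure.restrict_univ] at h6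
    have hwd : ∀ f : Ω → ℝ, ∫ x, f x ∂γ' = ∫ x, L x * f x ∂γ := by
      intro f
      rw [hγ', integral_withDensity_eq_integral_toReal_smul (by fun_prop)
        (Filter.Eventually.of_forall fun x => ENNReal.ofReal_lt_top)]
      refine integral_congr_ae (Filter.Eventually.of_forall fun x => ?_)
      simp [ENNReal.toReal_ofReal (Real.exp_pos _).le, hL]
    set χ : Ω → ℝ := Set.indicator {x | t < T x} 1 with hχ
    have hχm : Measurable χ := measurable_one.indicator hA
    have hχint : ∀ (ρ : Measure Ω), ∫ x, χ x ∂ρ = ρ.real {x | t < T x} := fun ρ =>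
      integral_indicator_one hA
    have hχ01 : ∀ x, χ x ∈ Set.Icc (0 : ℝ) 1 := fun x => by
      by_cases h : t < T x <;> simp [hχ, h]
    set k := Real.exp (a * t - a ^ 2 / 2)
    -- The Neyman–Pearson inequality: `L` is nondecreasing in `T` and equals `k` at `T = t`, so `χ`
    -- is 1 where `L > k` and 0 where `L < k`, up to ties. Integrating compares the powers of `χ`
    -- and `φ`.
    have hpt : ∀ x, 0 ≤ (χ x - φ x) * (L x - k) := by
      intro x
      by_cases h : t < T x
      · have h7 : χ x = 1 := by simp [hχ, h]
        rw [h7]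
        refine mul_nonneg (by linarith [(hφ01 x).2]) (sub_nonneg.2 (Real.exp_le_exp.2 ?_))
        have := mul_le_mul_of_nonneg_left h.le ha
        linarith
      · have h7 : χ x = 0 := by simp [hχ, h]
        rw [h7]
        refine mul_nonneg_of_nonpos_of_nonpos (by linarith [(hφ01 x).1])
          (sub_nonpos.2 (Real.exp_le_exp.2 ?_))
        have := mul_le_mul_of_nonneg_left (not_lt.1 h) ha
        linarith
    have hbd : ∀ f : Ω → ℝ, Measurable f → (∀ x, f x ∈ Set.Icc (0 : ℝ) 1) →
        Integrable (fun x => L x * f x) γ := fun f hf hf01 => by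
      refine hLint.mul_bdd (c := 1) hf.aestronglyMeasurable (Filter.Eventually.of_forall fun x => ?_)
      rw [Real.norm_eq_abs, abs_of_nonneg (hf01 x).1]; exact (hf01 x).2
    have hχi : Integrable χ γ := (integrable_const (1 : ℝ)).indicator hA
    have hnn := integral_nonneg (μ := γ) (f := fun x => (χ x - φ x) * (L x - k)) hpt
    have hexpand : ∫ x, (χ x - φ x) * (L x - k) ∂γ =
        (∫ x, L x * χ x ∂γ - ∫ x, L x * φ x ∂γ) - k * (∫ x, χ x ∂γ - ∫ x, φ x ∂γ) := by
      have i1 : Integrable (fun x => L x * χ x - L x * φ x) γ :=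
        (hbd χ hχm hχ01).sub (hbd φ hφ hφ01)
      have i2 : Integrable (fun x => k * (χ x - φ x)) γ := (hχi.sub (hint γ)).const_mul k
      rw [← integral_sub (hbd χ hχm hχ01) (hbd φ hφ hφ01), ← integral_sub hχi (hint γ),
        ← integral_const_mul, ← integral_sub i1 i2]
      refine integral_congr_ae (Filter.Eventually.of_forall fun x => ?_)
      simp only
      ring
    rw [hexpand, ← hwd, ← hwd, hχint, hχint, hsize] at hnn
    have hk : 0 ≤ k * (α - ∫ x, φ x ∂γ) :=
      mul_nonneg (Real.exp_pos _).le (by linarith)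
    linarith

/-- A shift of whitened length at most `b` of a Gaussian product law is `b`-Gaussian
indistinguishable from the law. -/
lemma integral_pi_gaussianReal_map_add_le {ι : Type*} [Fintype ι] (v : ι → ℝ≥0) (m : ι → ℝ)
    (hm : ∀ i, v i = 0 → m i = 0) {b : ℝ} (hb : 0 ≤ b) (hmb : ∑ i, m i ^ 2 / v i ≤ b ^ 2)
    {φ : (ι → ℝ) → ℝ} (hφ : Measurable φ) (hφ01 : ∀ x, φ x ∈ Set.Icc (0 : ℝ) 1)
    {α : ℝ} (hα01 : α ∈ Set.Icc (0 : ℝ) 1)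
    (hα : ∫ x, φ x ∂(Measure.pi fun i => gaussianReal 0 (v i)) ≤ α) :
    ∫ x, φ x ∂((Measure.pi fun i => gaussianReal 0 (v i)).map (fun x => x + m)) ≤
      1 - gaussianTradeoff b α := by
  set q := ∑ i, m i ^ 2 / (v i : ℝ) with hq
  have hq0 : 0 ≤ q := Finset.sum_nonneg fun i _ => by positivity
  rcases hq0.eq_or_lt with h0 | hpos
  -- A shift of whitened length zero is trivial: degenerate coordinates, where the quotient is zero
  -- by convention, are covered by `hm`.
  · have hm0 : m = 0 := by
      ext i
      have h1 := (Finset.sum_eq_zero_iff_of_nonneg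
        (fun (i : ι) (_ : i ∈ Finset.univ) => (by positivity : 0 ≤ m i ^ 2 / (v i : ℝ)))).1 h0.symm i
        (Finset.mem_univ i)
      rcases div_eq_zero_iff.1 h1 with h2 | h2
      · exact pow_eq_zero_iff two_ne_zero |>.1 h2
      · exact hm i (by exact_mod_cast h2)
    have h2 := gaussianTradeoff_antitone hb α
    rw [gaussianTradeoff_zero hα01] at h2
    simp only [hm0, add_zero, Measure.map_id']
    linarith
  · set a := √q with ha
    have ha0 : 0 < a := Real.sqrt_pos.2 hpos
    have haq : a ^ 2 = q := Real.sq_sqrt hq0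
    have hab : a ≤ b := by
      rw [ha]; exact Real.sqrt_le_iff.2 ⟨hb, hmb⟩
    -- The whitened projection onto the shift direction is the standard normal statistic along which
    -- the translate is an exponential tilt.
    have hlaw : (Measure.pi fun i => gaussianReal 0 (v i)).map
        (fun x : ι → ℝ => ∑ i, (m i / v i / a) * x i) = gaussianReal 0 1 := by
      refine map_sum_mul_pi_gaussianReal v _ 1 ?_
      have : ∀ i, (m i / v i / a) ^ 2 * v i = m i ^ 2 / v i / q := by
        intro i
        by_cases hv : v i = 0
        · simp [hv]
        · have : (v i : ℝ) ≠ 0 := by exact_mod_cast hv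
          rw [← haq]
          field_simp
      simp_rw [this]
      rw [← Finset.sum_div, ← hq, div_self hpos.ne', NNReal.coe_one]
    rw [pi_gaussianReal_map_add v m hm]
    have hdens : (fun x : ι → ℝ => ENNReal.ofReal
        (Real.exp ((∑ i, m i / v i * x i) - (∑ i, m i ^ 2 / v i) / 2))) =
        fun x => ENNReal.ofReal (Real.exp (a * (∑ i, (m i / v i / a) * x i) - a ^ 2 / 2)) := by
      ext x
      rw [haq, Finset.mul_sum]
      congr 3
      refine Finset.sum_congr rfl fun i _ => ?_
      field_simp
    rw [hdens]
    have h3 := integral_withDensity_exp_le (Measure.pi fun i => gaussianReal 0 (v i))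
      (by fun_prop) hlaw ha0.le hφ hφ01 hα
    linarith [gaussianTradeoff_antitone hab α]

end DPRidge

end

noncomputable section

/-! ### Privacy -/

namespace DPRidge

open scoped NNReal ENNReal

/-- The pair `(G, g)` built from a family of entries. -/
def noisePair (d : ℕ) (x : Sym2 (Fin d) ⊕ Fin d → ℝ) : (Fin d → Fin d → ℝ) × (Fin d → ℝ) :=
  (fun i j => x (Sum.inl s(i, j)), fun j => x (Sum.inr j))

@[fun_prop]
lemma measurable_noisePair (d : ℕ) : Measurable (noisePair d) := by
  unfold noisePair
  fun_prop

/-- Both noises are written as one Gaussian product with one coordinate per unordered pair or index,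
so that the shift bound applies once to the pair. -/
lemma privacyNoise_eq_map {d : ℕ} (n : ℕ) (S : Matrix (Fin d) (Fin d) ℝ)
    (β : EuclideanSpace ℝ (Fin d)) (η μ : ℝ) :
    privacyNoise n S β η μ = (Measure.pi fun i => gaussianReal 0 (Sum.elim
      (fun _ : Sym2 (Fin d) => (sigma₁ n S η μ ^ 2).toNNReal)
      (fun _ : Fin d => (sigma₂ n S β η μ ^ 2).toNNReal) i)).map (noisePair d) := by
  have h := (measurePreserving_sumPiEquivProdPi (X := fun _ : Sym2 (Fin d) ⊕ Fin d => ℝ)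
    (fun i => gaussianReal 0 (Sum.elim
      (fun _ : Sym2 (Fin d) => (sigma₁ n S η μ ^ 2).toNNReal)
      (fun _ : Fin d => (sigma₂ n S β η μ ^ 2).toNNReal) i))).map_eq
  simp only [Sum.elim_inl, Sum.elim_inr] at h
  have hg : Measurable (fun (w : Sym2 (Fin d) → ℝ) (i j : Fin d) => w s(i, j)) := by fun_prop
  have h2 : noisePair d = (Prod.map (fun (w : Sym2 (Fin d) → ℝ) (i j : Fin d) => w s(i, j)) id) ∘
      (MeasurableEquiv.sumPiEquivProdPi (fun _ : Sym2 (Fin d) ⊕ Fin d => ℝ)) := rfl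
  rw [h2, ← Measure.map_map (hg.prodMap measurable_id) (MeasurableEquiv.measurable _), h,
    ← Measure.map_prod_map _ _ hg measurable_id, Measure.map_id]
  rfl

instance {d : ℕ} (n : ℕ) (S : Matrix (Fin d) (Fin d) ℝ) (β : EuclideanSpace ℝ (Fin d))
    (η μ : ℝ) : IsProbabilityMeasure (privacyNoise n S β η μ) := by
  rw [privacyNoise_eq_map]
  exact Measure.isProbabilityMeasure_map (measurable_noisePair d).aemeasurable

lemma measurable_matrix_det {Ω : Type*} [MeasurableSpace Ω] {d : ℕ}
    {M : Ω → Matrix (Fin d) (Fin d) ℝ} (hM : ∀ i j, Measurable fun w => M w i j) :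
    Measurable fun w => (M w).det := by
  simp_rw [Matrix.det_apply]
  refine Finset.measurable_sum _ fun σ _ => ?_
  refine Measurable.const_smul (Finset.measurable_prod _ fun i _ => hM _ _) _

/-- The inverse is the adjugate divided by the determinant, also for singular matrices, where the
scalar inverse is zero. No invertibility is needed. -/
lemma measurable_matrix_inv {Ω : Type*} [MeasurableSpace Ω] {d : ℕ}
    {M : Ω → Matrix (Fin d) (Fin d) ℝ} (hM : ∀ i j, Measurable fun w => M w i j) (i j : Fin d) :
    Measurable fun w => (M w)⁻¹ i j := by
  simp_rw [Matrix.inv_def, Matrix.smul_apply, Ring.inverse_eq_inv', Matrix.adjugate_apply, smul_eq_mul]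
  refine (measurable_matrix_det hM).inv.mul (measurable_matrix_det fun k l => ?_)
  by_cases h : k = j
  · subst h
    simp
  · simpa [Matrix.updateRow_ne h] using hM k l

lemma measurable_mulVec_inv {Ω : Type*} [MeasurableSpace Ω] {d : ℕ}
    {M : Ω → Matrix (Fin d) (Fin d) ℝ} (hM : ∀ i j, Measurable fun w => M w i j)
    {b : Ω → Fin d → ℝ} (hb : ∀ i, Measurable fun w => b w i) :
    Measurable fun w => WithLp.toLp 2 (Matrix.mulVec (M w)⁻¹ (b w)) := by
  refine (PiLp.continuous_toLp 2 _).measurable.comp (measurable_pi_lambda _ fun i => ?_)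
  simp only [Matrix.mulVec, dotProduct]
  exact Finset.measurable_sum _ fun j _ => (measurable_matrix_inv hM i j).mul (hb j)

lemma measurable_dpRidge {d n : ℕ} (S : Matrix (Fin d) (Fin d) ℝ) (β : EuclideanSpace ℝ (Fin d))
    (lam η : ℝ) (D : Fin n → EuclideanSpace ℝ (Fin d) × ℝ) : Measurable (dpRidge S β lam η D) := by
  refine measurable_mulVec_inv (fun i j => ?_) (fun i => ?_)
  · simp only [Matrix.add_apply, Matrix.of_apply]
    fun_prop
  · simp only [Pi.add_apply]
    fun_prop

lemma norm_truncate_le {E : Type*} [NormedAddCommGroup E] [NormedSpace ℝ E] {R : ℝ} (hR : 0 ≤ R)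
    (x : E) : ‖truncate R x‖ ≤ R := by
  unfold truncate
  split_ifs with h
  · exact h
  · have hx : 0 < ‖x‖ := hR.trans_lt (not_le.1 h)
    rw [norm_smul, norm_div, norm_norm, div_mul_cancel₀ _ hx.ne', Real.norm_of_nonneg hR]

lemma sampleSecondMoment_symm {d n : ℕ} (D : Fin n → EuclideanSpace ℝ (Fin d) × ℝ) (i j : Fin d) :
    sampleSecondMoment D i j = sampleSecondMoment D j i := by
  simp [sampleSecondMoment, mul_comm]

lemma sum_sub_sum_of_neighbours {X : Type*} {n : ℕ} {D D' : Fin n → X} {k : Fin n}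
    (h : ∀ j, j ≠ k → D j = D' j) (f : X → ℝ) :
    ∑ i, f (D' i) - ∑ i, f (D i) = f (D' k) - f (D k) := by
  rw [← Finset.sum_sub_distrib]
  refine Finset.sum_eq_single k (fun j _ hj => ?_) (by simp)
  rw [h j hj, sub_self]

lemma sum_sq_mul_le {d : ℕ} (x : EuclideanSpace ℝ (Fin d)) {R : ℝ} (hx : ‖x‖ ≤ R) :
    ∑ i, x i ^ 2 ≤ R ^ 2 := by
  have h := EuclideanSpace.real_norm_sq_eq x
  rw [← h]
  exact pow_le_pow_left₀ (norm_nonneg _) hx 2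

/-- Sensitivity of the sample second moment. -/
lemma sum_sq_sampleSecondMoment_sub_le {d n : ℕ} {D D' : Fin n → EuclideanSpace ℝ (Fin d) × ℝ}
    {k : Fin n} (h : ∀ j, j ≠ k → D j = D' j) {R : ℝ} (hD : ‖(D k).1‖ ≤ R) (hD' : ‖(D' k).1‖ ≤ R) :
    ∑ i, ∑ j, (sampleSecondMoment D' i j - sampleSecondMoment D i j) ^ 2 ≤
      (2 * R ^ 2 / n) ^ 2 := by
  have e : ∀ i j, sampleSecondMoment D' i j - sampleSecondMoment D i j =
      ((D' k).1 i * (D' k).1 j - (D k).1 i * (D k).1 j) / n := fun i j => by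
    rw [← sum_sub_sum_of_neighbours h (fun x : EuclideanSpace ℝ (Fin d) × ℝ => x.1 i * x.1 j)]
    simp [sampleSecondMoment, sub_div]
  have h1 := sum_sq_mul_le _ hD
  have h2 := sum_sq_mul_le _ hD'
  have hsq : ∀ x : EuclideanSpace ℝ (Fin d), ∑ i, ∑ j, (x i * x j) ^ 2 = (∑ i, x i ^ 2) ^ 2 :=
    fun x => by
      rw [sq (∑ i, x i ^ 2), Finset.sum_mul_sum]
      simp_rw [mul_pow]
  calc ∑ i, ∑ j, (sampleSecondMoment D' i j - sampleSecondMoment D i j) ^ 2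
      ≤ ∑ i, ∑ j, (2 * ((D' k).1 i * (D' k).1 j) ^ 2 + 2 * ((D k).1 i * (D k).1 j) ^ 2) / n ^ 2 := by
        refine Finset.sum_le_sum fun i _ => Finset.sum_le_sum fun j _ => ?_
        rw [e, div_pow]
        gcongr
        nlinarith [sq_nonneg ((D' k).1 i * (D' k).1 j + (D k).1 i * (D k).1 j)]
    _ = (2 * (∑ i, (D' k).1 i ^ 2) ^ 2 + 2 * (∑ i, (D k).1 i ^ 2) ^ 2) / n ^ 2 := by
        rw [← hsq, ← hsq]
        simp_rw [← Finset.sum_div, Finset.sum_add_distrib, ← Finset.mul_sum]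
    _ ≤ (2 * (R ^ 2) ^ 2 + 2 * (R ^ 2) ^ 2) / n ^ 2 := by
        gcongr
    _ = (2 * R ^ 2 / n) ^ 2 := by ring

/-- Sensitivity of the sample cross moment. -/
lemma sum_sq_sampleCrossMoment_sub_le {d n : ℕ} {D D' : Fin n → EuclideanSpace ℝ (Fin d) × ℝ}
    {k : Fin n} (h : ∀ j, j ≠ k → D j = D' j) {R Q : ℝ} (hD : ‖(D k).1‖ ≤ R) (hD' : ‖(D' k).1‖ ≤ R)
    (hy : |(D k).2| ≤ Q) (hy' : |(D' k).2| ≤ Q) :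
    ∑ i, (sampleCrossMoment D' i - sampleCrossMoment D i) ^ 2 ≤ (2 * (R * Q) / n) ^ 2 := by
  have e : ∀ i, sampleCrossMoment D' i - sampleCrossMoment D i =
      ((D' k).1 i * (D' k).2 - (D k).1 i * (D k).2) / n := fun i => by
    rw [← sum_sub_sum_of_neighbours h (fun x : EuclideanSpace ℝ (Fin d) × ℝ => x.1 i * x.2)]
    simp [sampleCrossMoment, sub_div]
  have h1 := sum_sq_mul_le _ hD
  have h2 := sum_sq_mul_le _ hD'
  have h3 : (D k).2 ^ 2 ≤ Q ^ 2 := sq_le_sq' (by linarith [neg_abs_le (D k).2])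
    (by linarith [le_abs_self (D k).2])
  have h4 : (D' k).2 ^ 2 ≤ Q ^ 2 := sq_le_sq' (by linarith [neg_abs_le (D' k).2])
    (by linarith [le_abs_self (D' k).2])
  calc ∑ i, (sampleCrossMoment D' i - sampleCrossMoment D i) ^ 2
      ≤ ∑ i, (2 * ((D' k).1 i ^ 2 * (D' k).2 ^ 2) + 2 * ((D k).1 i ^ 2 * (D k).2 ^ 2)) / n ^ 2 := by
        refine Finset.sum_le_sum fun i _ => ?_
        rw [e, div_pow]
        gcongr
        nlinarith [sq_nonneg ((D' k).1 i * (D' k).2 + (D k).1 i * (D k).2)]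
    _ = (2 * ((∑ i, (D' k).1 i ^ 2) * (D' k).2 ^ 2) + 2 * ((∑ i, (D k).1 i ^ 2) * (D k).2 ^ 2))
          / n ^ 2 := by
        simp_rw [← Finset.sum_div, Finset.sum_add_distrib, ← Finset.mul_sum, ← Finset.sum_mul]
    _ ≤ (2 * (R ^ 2 * Q ^ 2) + 2 * (R ^ 2 * Q ^ 2)) / n ^ 2 := by
        gcongr
    _ = (2 * (R * Q) / n) ^ 2 := by ring

lemma radius_sq_pos {d n : ℕ} {S : Matrix (Fin d) (Fin d) ℝ} {η : ℝ} (hd : 0 < d) (hn : 0 < n)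
    (hS : S.PosSemidef) (h0 : 0 < η) (h1 : η < 1) : 0 < S.trace + d * Real.log (n / η) := by
  have h2 : 0 < Real.log (n / η) := Real.log_pos (by
    rw [lt_div_iff₀ h0]
    have : (1 : ℝ) ≤ n := by exact_mod_cast hn
    linarith)
  have h3 : (0 : ℝ) < d := by exact_mod_cast hd
  have h4 := hS.trace_nonneg
  positivity

/-- Choosing an ordered representative embeds unordered pairs into ordered ones. This bounds the
length of the shift in the independent entries by a Frobenius norm. -/
lemma sum_sym2_le_sum_sum {d : ℕ} (f : Sym2 (Fin d) → ℝ) (hf : ∀ p, 0 ≤ f p) :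
    ∑ p, f p ≤ ∑ i, ∑ j, f s(i, j) := by
  rw [← Fintype.sum_prod_type' (f := fun i j => f s(i, j))]
  have hsurj : Function.Surjective (fun p : Fin d × Fin d => s(p.1, p.2)) := by
    intro p
    induction p with | _ a b => exact ⟨(a, b), rfl⟩
  obtain ⟨g, hg⟩ := hsurj.hasRightInverse
  calc ∑ p, f p = ∑ p, f s((g p).1, (g p).2) := Finset.sum_congr rfl fun p _ => by
        rw [show s((g p).1, (g p).2) = p from hg p]
    _ = ∑ q ∈ Finset.univ.map ⟨g, hg.injective⟩, f s(q.1, q.2) := by simp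
    _ ≤ ∑ q : Fin d × Fin d, f s(q.1, q.2) :=
        Finset.sum_le_sum_of_subset_of_nonneg (Finset.subset_univ _) fun _ _ _ => hf _

/-- The private ridge regression is Gaussian differentially private. -/
theorem isGDP_dpRidgeLaw {d n : ℕ} (S : Matrix (Fin d) (Fin d) ℝ) (β : EuclideanSpace ℝ (Fin d))
    (lam : ℝ) {η μ : ℝ} (hd : 0 < d) (hn : 0 < n) (hS : S.PosSemidef) (hη0 : 0 < η) (hη1 : η < 1)
    (hμ : 0 < μ) : IsGDP (√2 * μ) (dpRidgeLaw (n := n) S β lam η μ) := by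
  refine ⟨fun D => Measure.isProbabilityMeasure_map (measurable_dpRidge S β lam η D).aemeasurable, ?_⟩
  rintro D D' ⟨k, hk⟩ α hα φ hφ hφ01 hφα
  have hR2 := radius_sq_pos hd hn hS hη0 hη1
  set R := radius n S η with hR
  have hRsq : R ^ 2 = S.trace + d * Real.log (n / η) := Real.sq_sqrt hR2.le
  have hR0 : 0 ≤ R := Real.sqrt_nonneg _
  have hn' : (0 : ℝ) < n := by exact_mod_cast hn
  set E := truncateData S β η D with hE
  set E' := truncateData S β η D' with hE'
  have hkE : ∀ j, j ≠ k → E j = E' j := fun j hj => by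
    simp only [hE, hE', truncateData, hk j hj]
  have hb : ∀ F : Fin n → EuclideanSpace ℝ (Fin d) × ℝ, ‖(truncateData S β η F k).1‖ ≤ R :=
    fun F => norm_truncate_le hR0 _
  have hy : ∀ F : Fin n → EuclideanSpace ℝ (Fin d) × ℝ, |(truncateData S β η F k).2| ≤ R * ‖β‖ :=
    fun F => norm_truncate_le (R := R * ‖β‖) (by positivity) (F k).2
  let Δ : Sym2 (Fin d) → ℝ := Sym2.lift ⟨fun i j => sampleSecondMoment E' i j -
    sampleSecondMoment E i j, fun i j =>
      congrArg₂ (· - ·) (sampleSecondMoment_symm E' i j) (sampleSecondMoment_symm E i j)⟩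
  let δ : Fin d → ℝ := fun j => sampleCrossMoment E' j - sampleCrossMoment E j
  set v : Sym2 (Fin d) ⊕ Fin d → ℝ≥0 := Sum.elim
      (fun _ : Sym2 (Fin d) => (sigma₁ n S η μ ^ 2).toNNReal)
      (fun _ : Fin d => (sigma₂ n S β η μ ^ 2).toNNReal) with hv
  let m : Sym2 (Fin d) ⊕ Fin d → ℝ := Sum.elim Δ δ
  have hs1 : sigma₁ n S η μ = 2 * R ^ 2 / n / μ := by
    rw [hRsq, sigma₁, div_div, mul_comm (n : ℝ)]
  have hs2 : sigma₂ n S β η μ = 2 * (R * (R * ‖β‖)) / n / μ := by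
    rw [sigma₂, ← hRsq, div_div, mul_comm (n : ℝ)]; ring
  have hR0' : 0 < R := by
    rcases hR0.eq_or_lt with h | h
    · rw [← h] at hRsq; norm_num at hRsq; linarith
    · exact h
  have hs1pos : 0 < sigma₁ n S η μ := by rw [hs1]; positivity
  have hδ := sum_sq_sampleCrossMoment_sub_le hkE (hb D) (hb D') (hy D) (hy D')
  have hΔ := sum_sq_sampleSecondMoment_sub_le hkE (hb D) (hb D')
  -- If β vanishes, `g` is degenerate and absorbs no shift; but then all responses are truncated to
  -- zero and the cross moment does not move.
  have hδ0 : β = 0 → ∀ i, δ i = 0 := by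
    intro hβ i
    rw [hβ, norm_zero] at hδ
    norm_num at hδ
    have h1 : ∑ i, δ i ^ 2 = 0 :=
      le_antisymm hδ (Finset.sum_nonneg fun i _ => sq_nonneg _)
    have := (Finset.sum_eq_zero_iff_of_nonneg (fun (i : Fin d) _ => sq_nonneg (δ i))).1 h1 i
      (Finset.mem_univ i)
    exact pow_eq_zero_iff two_ne_zero |>.1 this
  have hmv : ∀ i, v i = 0 → m i = 0 := by
    rintro (p | i) h
    · simp only [hv, Sum.elim_inl, Real.toNNReal_eq_zero] at h
      have : 0 < sigma₁ n S η μ ^ 2 := by positivity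
      linarith
    · simp only [hv, Sum.elim_inr, Real.toNNReal_eq_zero] at h
      refine hδ0 ?_ i
      have h1 : sigma₂ n S β η μ = 0 := pow_eq_zero_iff two_ne_zero |>.1 (le_antisymm h (sq_nonneg _))
      rw [hs2] at h1
      have h2 : 2 * (R * (R * ‖β‖)) = 0 := by
        field_simp at h1
        simpa using h1
      simpa [hR0'.ne'] using h2
  -- Each of the two noises is calibrated so that its sensitivity is at most μ standard deviations;
  -- the squares add up to 2μ².
  have hq : ∑ i, m i ^ 2 / v i ≤ (√2 * μ) ^ 2 := by
    rw [Fintype.sum_sum_type, mul_pow, Real.sq_sqrt zero_le_two, two_mul]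
    refine add_le_add ?_ ?_
    · simp only [m, hv, Sum.elim_inl, Real.coe_toNNReal _ (sq_nonneg _)]
      rw [← Finset.sum_div, div_le_iff₀ (by positivity), hs1]
      refine (sum_sym2_le_sum_sum _ fun p => sq_nonneg _).trans (hΔ.trans_eq ?_)
      field_simp
    · simp only [m, hv, Sum.elim_inr, Real.coe_toNNReal _ (sq_nonneg _)]
      by_cases hβ : β = 0
      · simp only [hδ0 hβ]
        norm_num
        positivity
      · have hβ' : 0 < ‖β‖ := norm_pos_iff.2 hβ
        have hs2pos : 0 < sigma₂ n S β η μ := by rw [hs2]; positivity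
        rw [← Finset.sum_div, div_le_iff₀ (by positivity), hs2]
        refine hδ.trans_eq ?_
        field_simp
  -- The change of data set is a translation of the noise by `m`; everything afterwards is
  -- post-processing by one fixed map.
  have hshift : ∀ x, dpRidge S β lam η D' (noisePair d x) = dpRidge S β lam η D (noisePair d (x + m)) := by
    intro x
    unfold dpRidge noisyRidge
    rw [← hE, ← hE']
    have hG : sampleSecondMoment E' + lam • (1 : Matrix (Fin d) (Fin d) ℝ) +
        Matrix.of (noisePair d x).1 = sampleSecondMoment E + lam • (1 : Matrix (Fin d) (Fin d) ℝ) +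
        Matrix.of (noisePair d (x + m)).1 := by
      ext i j
      simp [noisePair, m, Δ]
      ring
    have hg : sampleCrossMoment E' + (noisePair d x).2 =
        sampleCrossMoment E + (noisePair d (x + m)).2 := by
      ext j
      simp [noisePair, m, δ]
      ring
    rw [hG, hg]
  have hlaw : ∀ F, dpRidgeLaw S β lam η μ F = (Measure.pi fun i => gaussianReal 0 (v i)).map
      (fun x => dpRidge S β lam η F (noisePair d x)) := fun F => by
    rw [dpRidgeLaw, privacyNoise_eq_map, Measure.map_map (measurable_dpRidge S β lam η F)
      (measurable_noisePair d)]
    rfl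
  have hmeas : ∀ F : Fin n → EuclideanSpace ℝ (Fin d) × ℝ, Measurable
      (fun x => dpRidge S β lam η F (noisePair d x)) := fun F =>
    (measurable_dpRidge S β lam η F).comp (measurable_noisePair d)
  rw [hlaw, integral_map (hmeas D).aemeasurable hφ.aestronglyMeasurable] at hφα
  rw [hlaw, integral_map (hmeas D').aemeasurable hφ.aestronglyMeasurable]
  have key := integral_pi_gaussianReal_map_add_le v m hmv (by positivity) hq
    (hφ.comp (hmeas D)) (fun x => hφ01 _) hα hφα
  rw [integral_map (by fun_prop) (hφ.comp (hmeas D)).aestronglyMeasurable] at key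
  simp_rw [hshift]
  exact key

end DPRidge

end

noncomputable section

/-! ### Nets of the unit ball and operator norms -/

namespace DPRidge

open scoped NNReal ENNReal RealInnerProductSpace

section Net

variable {E : Type*} [NormedAddCommGroup E] [NormedSpace ℝ E] [FiniteDimensional ℝ E]

open Module in
/-- Volume bound for the size of a separated subset of the unit ball. -/
lemma card_le_of_separated_unitBall {ε : ℝ} (hε : 0 < ε) (s : Finset E) (hs : ∀ c ∈ s, ‖c‖ ≤ 1)
    (h : ∀ c ∈ s, ∀ d ∈ s, c ≠ d → ε ≤ ‖c - d‖) : (s.card : ℝ) ≤ (1 + 2 / ε) ^ finrank ℝ E := by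
  borelize E
  let μ : Measure E := Measure.addHaar
  have hρ : 0 < 1 + ε / 2 := by positivity
  have hε2 : 0 < ε / 2 := by positivity
  have hdisj : Set.Pairwise (s : Set E)
      (Function.onFun Disjoint fun c => Metric.ball (c : E) (ε / 2)) := by
    intro c hc d hd hcd
    apply Metric.ball_disjoint_ball
    rw [dist_eq_norm, add_halves]
    exact h c hc d hd hcd
  have hsub : (⋃ c ∈ s, Metric.ball c (ε / 2)) ⊆ Metric.ball (0 : E) (1 + ε / 2) := by
    refine Set.iUnion₂_subset fun x hx => Metric.ball_subset_ball' ?_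
    rw [dist_zero_right]
    linarith [hs x hx]
  have h1 : (s.card : ℝ≥0∞) * ENNReal.ofReal ((ε / 2) ^ finrank ℝ E) * μ (Metric.ball 0 1) ≤
      ENNReal.ofReal ((1 + ε / 2) ^ finrank ℝ E) * μ (Metric.ball 0 1) := by
    have h2 := measure_mono (μ := μ) hsub
    rw [measure_biUnion_finset hdisj fun c _ => measurableSet_ball,
      μ.addHaar_ball_of_pos _ hρ] at h2
    simp only [μ.addHaar_ball_of_pos _ hε2, Finset.sum_const, nsmul_eq_mul] at h2
    rwa [mul_assoc]
  have h3 := (ENNReal.mul_le_mul_iff_left (Metric.measure_ball_pos _ _ zero_lt_one).ne'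
    measure_ball_lt_top.ne).1 h1
  have h4 := ENNReal.toReal_le_of_le_ofReal (by positivity) h3
  rw [ENNReal.toReal_mul, ENNReal.toReal_natCast, ENNReal.toReal_ofReal (by positivity),
    ← le_div_iff₀ (by positivity), ← div_pow] at h4
  refine h4.trans_eq ?_
  congr 1
  field_simp
  ring

open Module in
/-- The unit ball has an `ε`-net of size `(1 + 2 / ε) ^ dim`. -/
lemma exists_net_unitBall {ε : ℝ} (hε : 0 < ε) :
    ∃ N : Finset E, (N.card : ℝ) ≤ (1 + 2 / ε) ^ finrank ℝ E ∧ (∀ v ∈ N, ‖v‖ ≤ 1) ∧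
      ∀ x : E, ‖x‖ ≤ 1 → ∃ v ∈ N, ‖x - v‖ ≤ ε := by
  classical
  let P : ℕ → Prop := fun k => ∃ s : Finset E, s.card = k ∧ (∀ c ∈ s, ‖c‖ ≤ 1) ∧
    ∀ c ∈ s, ∀ d ∈ s, c ≠ d → ε ≤ ‖c - d‖
  obtain ⟨B, hB⟩ := exists_nat_ge ((1 + 2 / ε) ^ finrank ℝ E)
  have hPB : ∀ k, P k → k ≤ B := by
    rintro k ⟨s, rfl, h1, h2⟩
    exact_mod_cast (card_le_of_separated_unitBall hε s h1 h2).trans hB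
  have hP0 : P 0 := ⟨∅, by simp⟩
  -- A separated set of maximal size is a net: a point far from all of its members could be added.
  obtain ⟨s, hcard, h1, h2⟩ : P (Nat.findGreatest P B) :=
    Nat.findGreatest_spec (Nat.zero_le B) hP0
  refine ⟨s, card_le_of_separated_unitBall hε s h1 h2, h1, fun x hx => ?_⟩
  by_contra! hcon
  have hxs : x ∉ s := fun hxs => by
    have := hcon x hxs
    rw [sub_self, norm_zero] at this
    linarith
  have hP : P (s.card + 1) := by
    refine ⟨insert x s, Finset.card_insert_of_notMem hxs, ?_, ?_⟩
    · intro c hc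
      rcases Finset.mem_insert.1 hc with rfl | hc
      · exact hx
      · exact h1 c hc
    · intro c hc d hd hcd
      rcases Finset.mem_insert.1 hc with rfl | hc' <;> rcases Finset.mem_insert.1 hd with rfl | hd'
      · exact absurd rfl hcd
      · exact (hcon d hd').le
      · rw [norm_sub_rev]; exact (hcon c hc').le
      · exact h2 c hc' d hd' hcd
  have := Nat.le_findGreatest (hPB _ hP) hP
  omega

end Net

/-- `N` is a `1/16`-net of the Euclidean unit ball with at most `33 ^ d` points. -/
structure IsFineNet {d : ℕ} (N : Finset (EuclideanSpace ℝ (Fin d))) : Prop where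
  card_le : (N.card : ℝ) ≤ 33 ^ d
  norm_le : ∀ v ∈ N, ‖v‖ ≤ 1
  exists_near : ∀ x : EuclideanSpace ℝ (Fin d), ‖x‖ ≤ 1 → ∃ v ∈ N, ‖x - v‖ ≤ 1 / 16

lemma exists_isFineNet (d : ℕ) : ∃ N : Finset (EuclideanSpace ℝ (Fin d)), IsFineNet N := by
  obtain ⟨N, h1, h2, h3⟩ := exists_net_unitBall (E := EuclideanSpace ℝ (Fin d))
    (ε := 1 / 16) (by norm_num)
  refine ⟨N, ?_, h2, h3⟩
  rw [finrank_euclideanSpace_fin] at h1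
  norm_num at h1
  exact_mod_cast h1

section

variable {d : ℕ} {N : Finset (EuclideanSpace ℝ (Fin d))}

/-- Replacing the unit vector along `y` by a nearby net point loses at most ‖y‖/16, whence the
factor 1/(1 - 1/16). -/
lemma IsFineNet.norm_le_of_inner_le (hN : IsFineNet N) {y : EuclideanSpace ℝ (Fin d)} {u : ℝ}
    (h : ∀ v ∈ N, |∑ i, v i * y i| ≤ u) : ‖y‖ ≤ 16 / 15 * u := by
  rcases eq_or_ne y 0 with rfl | hy
  · obtain ⟨v, hv, -⟩ := hN.exists_near 0 (by simp)
    have := (abs_nonneg _).trans (h v hv)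
    rw [norm_zero]; positivity
  have hy' : 0 < ‖y‖ := norm_pos_iff.2 hy
  have hx : ‖(‖y‖⁻¹ • y)‖ = 1 := by
    rw [norm_smul, norm_inv, norm_norm, inv_mul_cancel₀ hy'.ne']
  obtain ⟨v, hv, hxv⟩ := hN.exists_near (‖y‖⁻¹ • y) hx.le
  have h1 : ⟪v, y⟫ ≤ u := by
    have h2 := (le_abs_self _).trans (h v hv)
    rw [PiLp.inner_apply]
    simpa [mul_comm] using h2
  have h3 : ⟪‖y‖⁻¹ • y, y⟫ = ‖y‖ := by
    rw [real_inner_smul_left, real_inner_self_eq_norm_sq]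
    field_simp
  have h4 : ⟪‖y‖⁻¹ • y - v, y⟫ ≤ 1 / 16 * ‖y‖ :=
    (real_inner_le_norm _ _).trans (by gcongr)
  rw [inner_sub_left, h3] at h4
  linarith

lemma inner_toEuclideanCLM (M : Matrix (Fin d) (Fin d) ℝ) (x y : EuclideanSpace ℝ (Fin d)) :
    ⟪Matrix.toEuclideanCLM (n := Fin d) (𝕜 := ℝ) M x, y⟫ = ∑ i, ∑ j, y i * x j * M i j := by
  rw [PiLp.inner_apply]
  refine Finset.sum_congr rfl fun i _ => ?_
  rw [Matrix.ofLp_toEuclideanCLM]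
  simp only [Matrix.mulVec, dotProduct, RCLike.inner_apply, conj_trivial, Finset.mul_sum]
  exact Finset.sum_congr rfl fun j _ => by ring

lemma toEuclideanCLM_isSymmetric {M : Matrix (Fin d) (Fin d) ℝ} (hM : ∀ i j, M i j = M j i) :
    (Matrix.toEuclideanCLM (n := Fin d) (𝕜 := ℝ) M).IsSymmetric := by
  intro x y
  change ⟪Matrix.toEuclideanCLM (n := Fin d) (𝕜 := ℝ) M x, y⟫ =
    ⟪x, Matrix.toEuclideanCLM (n := Fin d) (𝕜 := ℝ) M y⟫
  rw [real_inner_comm _ x, inner_toEuclideanCLM, inner_toEuclideanCLM, Finset.sum_comm]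
  refine Finset.sum_congr rfl fun i _ => Finset.sum_congr rfl fun j _ => ?_
  rw [hM]
  ring

/-- For a symmetric matrix the norm is the supremum of the Rayleigh quotient. Moving both arguments
to the net costs 2 · (1/16) of the norm, whence 1/(1 - 1/8). -/
lemma IsFineNet.opNorm_le (hN : IsFineNet N) {M : Matrix (Fin d) (Fin d) ℝ}
    (hM : ∀ i j, M i j = M j i) {u : ℝ}
    (h : ∀ v ∈ N, |∑ i, ∑ j, v i * v j * M i j| ≤ u) : opNorm M ≤ 8 / 7 * u := by
  unfold opNorm
  set T := Matrix.toEuclideanCLM (n := Fin d) (𝕜 := ℝ) M with hT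
  have hsym : T.IsSymmetric := toEuclideanCLM_isSymmetric hM
  have hu : 0 ≤ u := by
    obtain ⟨v, hv, -⟩ := hN.exists_near 0 (by simp)
    exact (abs_nonneg _).trans (h v hv)
  have key : ‖T‖ ≤ u + 1 / 8 * ‖T‖ := by
    conv_lhs => rw [T.norm_eq_iSup_rayleighQuotient hsym]
    refine ciSup_le fun y => ?_
    rcases eq_or_ne y 0 with rfl | hy
    · rw [T.rayleighQuotient_apply_zero, abs_zero]; positivity
    have hy' : 0 < ‖y‖ := norm_pos_iff.2 hy
    set x := ‖y‖⁻¹ • y with hxdef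
    have hx : ‖x‖ = 1 := by
      rw [hxdef, norm_smul, norm_inv, norm_norm, inv_mul_cancel₀ hy'.ne']
    have hq : T.rayleighQuotient y = ⟪T x, x⟫ := by
      rw [← T.rayleigh_smul y (c := ‖y‖⁻¹) (inv_ne_zero hy'.ne'), ← hxdef]
      simp [ContinuousLinearMap.rayleighQuotient, ContinuousLinearMap.reApplyInnerSelf_apply, hx]
    obtain ⟨v, hv, hxv⟩ := hN.exists_near x hx.le
    have hv1 := hN.norm_le v hv
    have h1 : |⟪T v, v⟫| ≤ u := by
      rw [hT, inner_toEuclideanCLM]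
      exact h v hv
    have h2 : ⟪T x, x⟫ = ⟪T v, v⟫ + (⟪T (x - v), x⟫ + ⟪T v, x - v⟫) := by
      rw [map_sub, inner_sub_left, inner_sub_right]; ring
    have h3 : |⟪T (x - v), x⟫| ≤ 1 / 16 * ‖T‖ := by
      calc |⟪T (x - v), x⟫| ≤ ‖T (x - v)‖ * ‖x‖ := abs_real_inner_le_norm _ _
        _ ≤ (‖T‖ * ‖x - v‖) * 1 := by rw [hx]; gcongr; exact T.le_opNorm _
        _ ≤ (‖T‖ * (1 / 16)) * 1 := by gcongr
        _ = _ := by ring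
    have h4 : |⟪T v, x - v⟫| ≤ 1 / 16 * ‖T‖ := by
      calc |⟪T v, x - v⟫| ≤ ‖T v‖ * ‖x - v‖ := abs_real_inner_le_norm _ _
        _ ≤ (‖T‖ * ‖v‖) * (1 / 16) := by gcongr; exact T.le_opNorm _
        _ ≤ (‖T‖ * 1) * (1 / 16) := by gcongr
        _ = _ := by ring
    rw [hq, h2]
    calc _ ≤ |⟪T v, v⟫| + (|⟪T (x - v), x⟫| + |⟪T v, x - v⟫|) :=
          (abs_add_le _ _).trans (by gcongr; exact abs_add_le _ _)
      _ ≤ _ := by linarith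
  linarith

/-- Union bound over a net. -/
lemma IsFineNet.measure_biUnion_le (hN : IsFineNet N) {Ω : Type*} [MeasurableSpace Ω]
    (γ : Measure Ω) (A : EuclideanSpace ℝ (Fin d) → Set Ω) (hd : 0 < d) {z η : ℝ} (hη : 0 < η)
    (hz : 5 * d + Real.log (1 / η) ≤ z)
    (hA : ∀ v ∈ N, γ (A v) ≤ ENNReal.ofReal (2 * Real.exp (-z))) :
    γ (⋃ v ∈ N, A v) ≤ ENNReal.ofReal η := by
  calc γ (⋃ v ∈ N, A v) ≤ ∑ v ∈ N, γ (A v) := measure_biUnion_finset_le _ _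
    _ ≤ ∑ v ∈ N, ENNReal.ofReal (2 * Real.exp (-z)) := Finset.sum_le_sum hA
    _ = ENNReal.ofReal (N.card * (2 * Real.exp (-z))) := by
        rw [Finset.sum_const, nsmul_eq_mul, ENNReal.ofReal_mul (Nat.cast_nonneg _),
          ENNReal.ofReal_natCast]
    _ ≤ ENNReal.ofReal η := ENNReal.ofReal_le_ofReal ?_
  -- The 5 in the exponent pays for the net and for the two-sided tail: 2 · 33^d ≤ 66^d and 66 ≤ e⁵.
  have h1 : (33 : ℝ) ^ d * 2 ≤ Real.exp (5 * d) := by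
    have h2 : (66 : ℝ) ≤ Real.exp 5 := by
      have h3 : Real.exp 5 = Real.exp 1 ^ 5 := by
        rw [← Real.exp_nat_mul]; norm_num
      rw [h3]
      calc (66 : ℝ) ≤ 2.7 ^ 5 := by norm_num
        _ ≤ _ := pow_le_pow_left₀ (by norm_num) (by linarith [Real.exp_one_gt_d9]) 5
    calc (33 : ℝ) ^ d * 2 ≤ 33 ^ d * 2 ^ d := by
          gcongr
          exact le_self_pow₀ (by norm_num) hd.ne'
      _ = 66 ^ d := by rw [← mul_pow]; norm_num
      _ ≤ Real.exp 5 ^ d := by gcongr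
      _ = Real.exp (5 * d) := by rw [← Real.exp_nat_mul, mul_comm]
  calc N.card * (2 * Real.exp (-z)) ≤ 33 ^ d * (2 * Real.exp (-(5 * d + Real.log (1 / η)))) := by
        gcongr
        exact hN.card_le
    _ = (33 ^ d * 2) * Real.exp (-(5 * d)) * η := by
        rw [neg_add, Real.exp_add, one_div, Real.log_inv, neg_neg, Real.exp_log hη]; ring
    _ ≤ Real.exp (5 * d) * Real.exp (-(5 * d)) * η := by gcongr
    _ = η := by rw [← Real.exp_add, add_neg_cancel, Real.exp_zero, one_mul]

end

end DPRidge

end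

noncomputable section

/-! ### Lower bound for the sample second moment -/

namespace DPRidge

open scoped NNReal ENNReal Matrix

/-- The difference of the two sides vanishes at `y = 0`, and its derivative is nonnegative by
convexity of the exponential between 0 and `y`. -/
lemma exp_mul_le_of_nonneg {θ y : ℝ} (hy : 0 ≤ y) (hθ0 : 0 ≤ θ) (hθ1 : θ ≤ 1) :
    Real.exp (θ * y) ≤ 1 + θ * y + θ ^ 2 * (Real.exp y - 1 - y) := by
  let g : ℝ → ℝ := fun y => 1 + θ * y + θ ^ 2 * (Real.exp y - 1 - y) - Real.exp (θ * y)
  have hg : ∀ y, HasDerivAt g (θ + θ ^ 2 * (Real.exp y - 1) - Real.exp (θ * y) * θ) y := by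
    intro y
    have h1 : HasDerivAt (fun y : ℝ => θ * y) θ y := by
      simpa using (hasDerivAt_id y).const_mul θ
    have h2 := ((h1.const_add 1).add
      ((((Real.hasDerivAt_exp y).sub_const 1).sub (hasDerivAt_id y)).const_mul (θ ^ 2))).sub h1.exp
    exact h2
  have hmono : MonotoneOn g (Set.Ici 0) := by
    refine monotoneOn_of_deriv_nonneg (convex_Ici 0)
      (fun y _ => (hg y).continuousAt.continuousWithinAt)
      (fun y _ => (hg y).differentiableAt.differentiableWithinAt) fun y _ => ?_
    rw [(hg y).deriv]
    have hconv := convexOn_exp.2 (Set.mem_univ (0 : ℝ)) (Set.mem_univ y)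
      (sub_nonneg.2 hθ1) hθ0 (by ring)
    simp only [smul_eq_mul, mul_zero, zero_add, Real.exp_zero, mul_one] at hconv
    nlinarith
  have h := hmono (Set.mem_Ici.2 le_rfl) (Set.mem_Ici.2 hy) hy
  simp only [g, mul_zero, Real.exp_zero] at h
  linarith

/-- Follows from exp z ≥ 1 + z + z²/2 and (1 + z + z²/2)(1 - z + z²/2) = 1 + z⁴/4 ≥ 1. -/
lemma exp_neg_le_quadratic {z : ℝ} (hz : 0 ≤ z) : Real.exp (-z) ≤ 1 - z + z ^ 2 / 2 := by
  have h1 := Real.quadratic_le_exp_of_nonneg hz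
  rw [Real.exp_neg, inv_le_comm₀ (Real.exp_pos _) (by nlinarith [sq_nonneg (z - 1)])]
  refine le_trans ?_ h1
  rw [inv_le_iff_one_le_mul₀ (by nlinarith [sq_nonneg (z - 1)])]
  nlinarith [pow_nonneg hz 4]

/-- Second-order bound for `exp (θ y)` in terms of `exp y`. -/
lemma exp_mul_le {θ y : ℝ} (hy : 0 ≤ y) (hθ : |θ| ≤ 1) :
    Real.exp (θ * y) ≤ 1 + θ * y + θ ^ 2 * (Real.exp y - 1 - y) := by
  rcases le_total 0 θ with h | h
  · exact exp_mul_le_of_nonneg hy h ((le_abs_self θ).trans hθ)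
  · have h1 := exp_neg_le_quadratic (z := -θ * y) (mul_nonneg (by linarith) hy)
    have h2 := Real.quadratic_le_exp_of_nonneg hy
    have h3 : -(-θ * y) = θ * y := by ring
    rw [h3] at h1
    nlinarith [mul_le_mul_of_nonneg_left h2 (sq_nonneg θ)]

/-! ### Bernstein's inequality under an exponential moment -/

section Bernstein

variable {X : Type*} [MeasurableSpace X] {ν : Measure X} {f : X → ℝ}

lemma integrable_exp_of_lintegral_le (hf : Measurable f)
    (h : ∫⁻ x, ENNReal.ofReal (Real.exp (f x)) ∂ν ≤ 2) : Integrable (fun x => Real.exp (f x)) ν := by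
  refine ⟨(Real.measurable_exp.comp hf).aestronglyMeasurable, ?_⟩
  rw [hasFiniteIntegral_iff_ofReal (Filter.Eventually.of_forall fun x => (Real.exp_pos _).le)]
  exact h.trans_lt (by simp)

lemma integral_exp_le_of_lintegral_le (h : ∫⁻ x, ENNReal.ofReal (Real.exp (f x)) ∂ν ≤ 2)
    (hf : Measurable f) : ∫ x, Real.exp (f x) ∂ν ≤ 2 := by
  rw [integral_eq_lintegral_of_nonneg_ae (Filter.Eventually.of_forall fun x => (Real.exp_pos _).le)
    (Real.measurable_exp.comp hf).aestronglyMeasurable]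
  exact ENNReal.toReal_le_of_le_ofReal zero_le_two (by simpa using h)

lemma integrable_of_lintegral_exp_le (hf : Measurable f) (hf0 : ∀ x, 0 ≤ f x)
    (h : ∫⁻ x, ENNReal.ofReal (Real.exp (f x)) ∂ν ≤ 2) : Integrable f ν :=
  (integrable_exp_of_lintegral_le hf h).mono' hf.aestronglyMeasurable
    (Filter.Eventually.of_forall fun x => by
      rw [Real.norm_of_nonneg (hf0 x)]
      linarith [Real.add_one_le_exp (f x)])

variable [IsProbabilityMeasure ν]

/-- Integrating `exp_mul_le` and using E e^f ≤ 2 gives E e^(θf) ≤ 1 + θp + θ² ≤ e^(θp + θ²), with p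
the mean. The free constant `w` lets the Chernoff normalization sit inside the exponent. -/
lemma lintegral_exp_mul_sub_le (hf : Measurable f) (hf0 : ∀ x, 0 ≤ f x)
    (h : ∫⁻ x, ENNReal.ofReal (Real.exp (f x)) ∂ν ≤ 2) {θ : ℝ} (hθ : |θ| ≤ 1) (w : ℝ) :
    ∫⁻ x, ENNReal.ofReal (Real.exp (θ * (f x - ∫ x, f x ∂ν) - w)) ∂ν ≤
      ENNReal.ofReal (Real.exp (θ ^ 2 - w)) := by
  set p := ∫ x, f x ∂ν with hp
  have hi1 := integrable_exp_of_lintegral_le hf h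
  have hi2 := integrable_of_lintegral_exp_le hf hf0 h
  have hp0 : 0 ≤ p := integral_nonneg hf0
  have hbi : Integrable (fun x => 1 + θ * f x + θ ^ 2 * (Real.exp (f x) - 1 - f x)) ν :=
    ((integrable_const 1).add (hi2.const_mul θ)).add
      (((hi1.sub (integrable_const 1)).sub hi2).const_mul _)
  have hbound : ∀ x, Real.exp (θ * (f x - p) - w) ≤
      Real.exp (-(θ * p) - w) * (1 + θ * f x + θ ^ 2 * (Real.exp (f x) - 1 - f x)) := by
    intro x
    have : θ * (f x - p) - w = (-(θ * p) - w) + θ * f x := by ring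
    rw [this, Real.exp_add]
    exact mul_le_mul_of_nonneg_left (exp_mul_le (hf0 x) hθ) (Real.exp_pos _).le
  calc ∫⁻ x, ENNReal.ofReal (Real.exp (θ * (f x - p) - w)) ∂ν
      ≤ ∫⁻ x, ENNReal.ofReal (Real.exp (-(θ * p) - w) *
          (1 + θ * f x + θ ^ 2 * (Real.exp (f x) - 1 - f x))) ∂ν :=
        lintegral_mono fun x => ENNReal.ofReal_le_ofReal (hbound x)
    _ = ENNReal.ofReal (∫ x, Real.exp (-(θ * p) - w) *
          (1 + θ * f x + θ ^ 2 * (Real.exp (f x) - 1 - f x)) ∂ν) :=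
        (ofReal_integral_eq_lintegral_ofReal (hbi.const_mul _)
          (Filter.Eventually.of_forall fun x => (Real.exp_pos _).le.trans (hbound x))).symm
    _ ≤ ENNReal.ofReal (Real.exp (θ ^ 2 - w)) := ENNReal.ofReal_le_ofReal ?_
  have hint : ∫ x, (1 + θ * f x + θ ^ 2 * (Real.exp (f x) - 1 - f x)) ∂ν =
      1 + θ * p + θ ^ 2 * (∫ x, Real.exp (f x) ∂ν - 1 - p) := by
    have j1 : Integrable (fun x => 1 + θ * f x) ν := (integrable_const 1).add (hi2.const_mul θ)
    have j2 : Integrable (fun x => Real.exp (f x) - 1) ν := hi1.sub (integrable_const 1)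
    have j3 : Integrable (fun x => Real.exp (f x) - 1 - f x) ν := j2.sub hi2
    rw [integral_add j1 (j3.const_mul _), integral_add (integrable_const 1) (hi2.const_mul θ),
      integral_const_mul, integral_const_mul, integral_sub j2 hi2,
      integral_sub hi1 (integrable_const 1)]
    simp [hp]
  have hle : 1 + θ * p + θ ^ 2 * (∫ x, Real.exp (f x) ∂ν - 1 - p) ≤ Real.exp (θ * p + θ ^ 2) := by
    refine le_trans ?_ (Real.add_one_le_exp _)
    nlinarith [integral_exp_le_of_lintegral_le h hf, sq_nonneg θ, mul_nonneg (sq_nonneg θ) hp0]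
  rw [integral_const_mul, hint]
  calc _ ≤ Real.exp (-(θ * p) - w) * Real.exp (θ * p + θ ^ 2) :=
        mul_le_mul_of_nonneg_left hle (Real.exp_pos _).le
    _ = Real.exp (θ ^ 2 - w) := by rw [← Real.exp_add]; congr 1; ring

/-- Chernoff bound with θ = st/2, where the sign `s` selects the tail. Each factor contributes t²/4
- t²/2 = -t²/4 to the exponent, and t ≤ 2 ensures |θ| ≤ 1. -/
lemma measure_pi_sum_ge_le (n : ℕ) (hf : Measurable f) (hf0 : ∀ x, 0 ≤ f x)
    (h : ∫⁻ x, ENNReal.ofReal (Real.exp (f x)) ∂ν ≤ 2) {t s : ℝ} (ht : 0 ≤ t) (ht2 : t ≤ 2)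
    (hs : |s| = 1) :
    (Measure.pi fun _ : Fin n => ν) {A | n * t ≤ s * ∑ i, (f (A i) - ∫ x, f x ∂ν)} ≤
      ENNReal.ofReal (Real.exp (-(n * t ^ 2 / 4))) := by
  set p := ∫ x, f x ∂ν with hp
  set F : X → ℝ≥0∞ := fun x => ENNReal.ofReal (Real.exp ((s * t / 2) * (f x - p) - t ^ 2 / 2))
    with hF
  have hFm : Measurable F := by fun_prop
  have hPm : Measurable fun A : Fin n → X => ∏ i, F (A i) :=
    Finset.measurable_prod _ fun i _ => hFm.comp (measurable_pi_apply i)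
  have hs2 : s ^ 2 = 1 := by rw [← sq_abs, hs, one_pow]
  have hsub : {A : Fin n → X | n * t ≤ s * ∑ i, (f (A i) - p)} ⊆ {A | 1 ≤ ∏ i, F (A i)} := by
    intro A hA
    have hA' : n * t ≤ s * ∑ i, (f (A i) - p) := hA
    simp only [Set.mem_ofPred_eq, hF]
    rw [← ENNReal.ofReal_prod_of_nonneg (fun i _ => (Real.exp_pos _).le), ← Real.exp_sum,
      ← ENNReal.ofReal_one]
    refine ENNReal.ofReal_le_ofReal (Real.one_le_exp ?_)
    rw [Finset.sum_sub_distrib, ← Finset.mul_sum]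
    simp only [Finset.sum_const, Finset.card_univ, Fintype.card_fin, nsmul_eq_mul]
    nlinarith [mul_le_mul_of_nonneg_left hA' ht]
  have hind : iIndepFun (fun (i : Fin n) (A : Fin n → X) => F (A i)) (Measure.pi fun _ => ν) :=
    iIndepFun_pi (fun i => hFm.aemeasurable)
  have habs : |s * t / 2| ≤ 1 := by
    rw [abs_div, abs_mul, hs, one_mul, abs_of_nonneg ht, abs_two]
    linarith
  calc _ ≤ (Measure.pi fun _ : Fin n => ν) {A | 1 ≤ ∏ i, F (A i)} := measure_mono hsub
    _ ≤ (∫⁻ A, ∏ i, F (A i) ∂(Measure.pi fun _ : Fin n => ν)) / 1 :=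
        meas_ge_le_lintegral_div hPm.aemeasurable one_ne_zero ENNReal.one_ne_top
    _ = ∏ _i : Fin n, ∫⁻ x, F x ∂ν := by
        rw [div_one, lintegral_prod_eq_prod_lintegral_of_indepFun Finset.univ _ hind
          (fun i => hFm.comp (measurable_pi_apply i))]
        refine Finset.prod_congr rfl fun i _ => ?_
        exact (measurePreserving_eval (fun _ : Fin n => ν) i).lintegral_comp hFm
    _ ≤ ∏ _i : Fin n, ENNReal.ofReal (Real.exp (-(t ^ 2 / 4))) := by
        refine Finset.prod_le_prod' fun i _ => ?_
        refine (lintegral_exp_mul_sub_le hf hf0 h habs _).trans_eq ?_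
        congr 2
        nlinarith
    _ = ENNReal.ofReal (Real.exp (-(n * t ^ 2 / 4))) := by
        rw [Finset.prod_const, Finset.card_univ, Fintype.card_fin,
          ← ENNReal.ofReal_pow (Real.exp_pos _).le, ← Real.exp_nat_mul]
        congr 2
        ring

/-- Bernstein's inequality for averages of nonnegative variables with exponential moments. -/
lemma measure_pi_average_sub_gt_le {n : ℕ} (hn : 0 < n) (hf : Measurable f) (hf0 : ∀ x, 0 ≤ f x)
    (h : ∫⁻ x, ENNReal.ofReal (Real.exp (f x)) ∂ν ≤ 2) {t : ℝ} (ht : 0 ≤ t) (ht2 : t ≤ 2) :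
    (Measure.pi fun _ : Fin n => ν) {A | t < |(∑ i, f (A i)) / n - ∫ x, f x ∂ν|} ≤
      ENNReal.ofReal (2 * Real.exp (-(n * t ^ 2 / 4))) := by
  have hn' : (0 : ℝ) < n := by exact_mod_cast hn
  have hsub : {A : Fin n → X | t < |(∑ i, f (A i)) / n - ∫ x, f x ∂ν|} ⊆
      {A | n * t ≤ 1 * ∑ i, (f (A i) - ∫ x, f x ∂ν)} ∪
      {A | n * t ≤ -1 * ∑ i, (f (A i) - ∫ x, f x ∂ν)} := by
    intro A hA
    have e : ∑ i, (f (A i) - ∫ x, f x ∂ν) = n * ((∑ i, f (A i)) / n - ∫ x, f x ∂ν) := by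
      rw [Finset.sum_sub_distrib]
      simp only [Finset.sum_const, Finset.card_univ, Fintype.card_fin, nsmul_eq_mul]
      field_simp
    simp only [Set.mem_union, Set.mem_ofPred_eq]
    rw [e]
    rcases lt_abs.1 (show t < |(∑ i, f (A i)) / n - ∫ x, f x ∂ν| from hA) with h1 | h1
    · left
      rw [one_mul]
      exact mul_le_mul_of_nonneg_left h1.le hn'.le
    · right
      have := mul_le_mul_of_nonneg_left h1.le hn'.le
      linarith
  refine (measure_mono hsub).trans ((measure_union_le _ _).trans ?_)
  have h1 := measure_pi_sum_ge_le n hf hf0 h ht ht2 (s := 1) (by simp)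
  have h2 := measure_pi_sum_ge_le n hf hf0 h ht ht2 (s := -1) (by simp)
  refine (add_le_add h1 h2).trans_eq ?_
  rw [← ENNReal.ofReal_add (Real.exp_pos _).le (Real.exp_pos _).le, two_mul]

end Bernstein

/-! ### Quadratic forms of sub-Gaussian vectors -/

section SubGaussian

variable {d : ℕ} {ν : Measure (EuclideanSpace ℝ (Fin d))} {S : Matrix (Fin d) (Fin d) ℝ} {K : ℝ}

lemma dotProduct_mulVec_eq_sum (M : Matrix (Fin d) (Fin d) ℝ) (u : Fin d → ℝ) :
    u ⬝ᵥ M *ᵥ u = ∑ i, ∑ j, u i * u j * M i j := by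
  simp only [dotProduct, Matrix.mulVec, Finset.mul_sum]
  exact Finset.sum_congr rfl fun i _ => Finset.sum_congr rfl fun j _ => by ring

lemma sq_sum_mul_eq (u x : Fin d → ℝ) :
    (∑ i, u i * x i) ^ 2 = ∑ i, ∑ j, u i * u j * (x i * x j) := by
  rw [sq, Finset.sum_mul_sum]
  exact Finset.sum_congr rfl fun i _ => Finset.sum_congr rfl fun j _ => by ring

lemma dotProduct_sampleSecondMoment_mulVec {n : ℕ} (D : Fin n → EuclideanSpace ℝ (Fin d) × ℝ)
    (u : Fin d → ℝ) :
    u ⬝ᵥ sampleSecondMoment D *ᵥ u = (∑ i, (∑ j, u j * (D i).1 j) ^ 2) / n := by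
  rw [dotProduct_mulVec_eq_sum]
  simp_rw [sq_sum_mul_eq, sampleSecondMoment, Matrix.of_apply, Finset.sum_div, Finset.mul_sum]
  refine Eq.symm (Finset.sum_comm.trans (Finset.sum_congr rfl fun i _ => ?_))
  refine Finset.sum_comm.trans (Finset.sum_congr rfl fun j _ => Finset.sum_congr rfl fun k _ => ?_)
  ring

lemma IsSubGaussian.integral_sq (h : IsSubGaussian ν S K) (u : Fin d → ℝ) :
    ∫ x : EuclideanSpace ℝ (Fin d), (∑ i, u i * x i) ^ 2 ∂ν = u ⬝ᵥ S *ᵥ u := by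
  simp_rw [sq_sum_mul_eq]
  rw [dotProduct_mulVec_eq_sum, integral_finsetSum _ fun i _ => integrable_finsetSum _ fun j _ =>
    (h.integrable i j).const_mul _]
  refine Finset.sum_congr rfl fun i _ => ?_
  rw [integral_finsetSum _ fun j _ => (h.integrable i j).const_mul _]
  refine Finset.sum_congr rfl fun j _ => ?_
  rw [integral_const_mul, h.second_moment]

lemma IsSubGaussian.symm (h : IsSubGaussian ν S K) (i j : Fin d) : S i j = S j i := by
  rw [← h.second_moment, ← h.second_moment]
  simp_rw [mul_comm]

lemma IsSubGaussian.posSemidef (h : IsSubGaussian ν S K) : S.PosSemidef := by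
  refine Matrix.PosSemidef.of_dotProduct_mulVec_nonneg (by ext i j; simp [h.symm i j]) fun u => ?_
  rw [star_trivial, ← h.integral_sq]
  exact integral_nonneg fun x => sq_nonneg _

/-- Concentration of the second moment in one direction. -/
lemma IsSubGaussian.measure_direction_le (h : IsSubGaussian ν S K) (hK : 0 < K) {n : ℕ}
    (hn : 0 < n) (w : Fin d → ℝ) (hw1 : w ⬝ᵥ S *ᵥ w ≤ 1) (hw0 : w ⬝ᵥ S *ᵥ w = 0 → w = 0)
    {u : ℝ} (hu0 : 0 ≤ u) (hu1 : u ≤ 1) :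
    (Measure.pi fun _ : Fin n => ν)
      {A | u < |(∑ i, (∑ j, w j * A i j) ^ 2) / n - w ⬝ᵥ S *ᵥ w|} ≤
      ENNReal.ofReal (2 * Real.exp (-(n * (u / K ^ 2) ^ 2 / 4))) := by
  have := h.prob
  set q := w ⬝ᵥ S *ᵥ w with hq
  have hq0 : 0 ≤ q := by
    have := h.posSemidef.dotProduct_mulVec_nonneg w
    rwa [star_trivial] at this
  rcases hq0.eq_or_lt with h0 | hpos
  -- At zero variance the ψ₂ condition carries no information, but then `w = 0` and the deviation
  -- vanishes identically.
  · have hw := hw0 h0.symm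
    have : {A : Fin n → EuclideanSpace ℝ (Fin d) |
        u < |(∑ i, (∑ j, w j * A i j) ^ 2) / n - q|} = ∅ := by
      ext A
      simp [hw, ← h0, hu0]
    rw [this, measure_empty]
    exact zero_le
  set f : EuclideanSpace ℝ (Fin d) → ℝ := fun x => (∑ j, w j * x j) ^ 2 / (K ^ 2 * q) with hf
  have hfm : Measurable f := by fun_prop
  have hf0 : ∀ x, 0 ≤ f x := fun x => by positivity
  have hfe := h.psi_two w
  have hfint : ∫ x, f x ∂ν = 1 / K ^ 2 := by
    simp only [hf]
    rw [integral_div, h.integral_sq, ← hq]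
    field_simp
  -- The ψ₂ bound forces K ≥ 1, since f ≤ e^f - 1 has mean at most 1. Hence the rescaled deviation
  -- u/K² stays in the range of Bernstein's inequality.
  have hK1 : 1 / K ^ 2 ≤ 1 := by
    rw [← hfint]
    calc ∫ x, f x ∂ν ≤ ∫ x, (Real.exp (f x) - 1) ∂ν :=
          integral_mono (integrable_of_lintegral_exp_le hfm hf0 hfe)
            ((integrable_exp_of_lintegral_le hfm hfe).sub (integrable_const 1))
            fun x => by linarith [Real.add_one_le_exp (f x)]
      _ = ∫ x, Real.exp (f x) ∂ν - 1 := by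
          rw [integral_sub (integrable_exp_of_lintegral_le hfm hfe) (integrable_const 1)]; simp
      _ ≤ 1 := by linarith [integral_exp_le_of_lintegral_le hfe hfm]
  have hu2 : u / K ^ 2 ≤ 2 := by
    rw [div_eq_mul_one_div]
    nlinarith [sq_nonneg K]
  have hn' : (0 : ℝ) < n := by exact_mod_cast hn
  refine le_trans (measure_mono fun A hA => ?_)
    (measure_pi_average_sub_gt_le hn hfm hf0 hfe (by positivity) hu2)
  have hA' : u < |(∑ i, (∑ j, w j * A i j) ^ 2) / n - q| := hA
  have e : (∑ i, f (A i)) / n - ∫ x, f x ∂ν =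
      ((∑ i, (∑ j, w j * A i j) ^ 2) / n - q) / (K ^ 2 * q) := by
    rw [hfint]
    simp only [hf]
    rw [← Finset.sum_div]
    field_simp
  change u / K ^ 2 < |(∑ i, f (A i)) / n - ∫ x, f x ∂ν|
  rw [e, abs_div, abs_of_pos (by positivity : 0 < K ^ 2 * q), lt_div_iff₀ (by positivity)]
  calc u / K ^ 2 * (K ^ 2 * q) = u * q := by field_simp
    _ ≤ u * 1 := by gcongr
    _ < _ := by linarith

end SubGaussian

/-! ### The smallest eigenvalue as a lower bound of the quadratic form -/

section LambdaMin

variable {d : ℕ} {S : Matrix (Fin d) (Fin d) ℝ}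

/-- Subtracting the smallest eigenvalue times the identity shifts the spectrum into the nonnegative
half-line, so the difference is positive semidefinite. -/
lemma lambdaMin_mul_le (hS : S.IsHermitian) (x : Fin d → ℝ) :
    lambdaMin S * (x ⬝ᵥ x) ≤ x ⬝ᵥ S *ᵥ x := by
  have hps : (S - algebraMap ℝ (Matrix (Fin d) (Fin d) ℝ) (lambdaMin S)).PosSemidef := by
    refine Matrix.posSemidef_iff_isHermitian_and_spectrum_nonneg.2 ⟨?_, ?_⟩
    · refine hS.sub ?_
      rw [Matrix.algebraMap_eq_diagonal]
      exact Matrix.isHermitian_diagonal _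
    · rw [← spectrum.sub_singleton_eq]
      rintro _ ⟨a, ha, b, rfl, rfl⟩
      exact sub_nonneg.2 (csInf_le (Matrix.finite_real_spectrum (A := S)).bddBelow ha)
  have h := hps.dotProduct_mulVec_nonneg x
  rw [star_trivial, Matrix.sub_mulVec, dotProduct_sub, Algebra.algebraMap_eq_smul_one,
    Matrix.smul_mulVec, Matrix.one_mulVec, dotProduct_smul, smul_eq_mul] at h
  linarith

lemma lambdaMin_nonneg (hS : S.PosSemidef) : 0 ≤ lambdaMin S :=
  Real.sInf_nonneg fun _ ha =>
    (Matrix.posSemidef_iff_isHermitian_and_spectrum_nonneg.1 hS).2 ha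

end LambdaMin

/-- Lower bound for the sample second moment of independent sub-Gaussian vectors. -/
theorem IsSubGaussian.exists_sampleSecondMoment_ge {d n : ℕ}
    {ν : Measure (EuclideanSpace ℝ (Fin d))} {S : Matrix (Fin d) (Fin d) ℝ} {K η : ℝ}
    (h : IsSubGaussian ν S K) (hK : 0 < K) (hd : 0 < d) (hn : 0 < n) (hη0 : 0 < η) (hη1 : η < 1)
    (hs : 0 ≤ shrink (6 * K ^ 2) d n η) :
    ∃ good : Set (Fin n → EuclideanSpace ℝ (Fin d)), MeasurableSet good ∧
      (Measure.pi fun _ : Fin n => ν) goodᶜ ≤ ENNReal.ofReal η ∧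
      ∀ D : Fin n → EuclideanSpace ℝ (Fin d) × ℝ, (fun i => (D i).1) ∈ good →
        ∀ x : Fin d → ℝ, lambdaMin S * shrink (6 * K ^ 2) d n η ^ 2 * (x ⬝ᵥ x) ≤
          x ⬝ᵥ sampleSecondMoment D *ᵥ x := by
  rcases (lambdaMin_nonneg h.posSemidef).eq_or_lt with h0 | hpos
  · refine ⟨Set.univ, MeasurableSet.univ, by simp, fun D _ x => ?_⟩
    rw [← h0, zero_mul, zero_mul, dotProduct_sampleSecondMoment_mulVec]
    positivity
  set s := shrink (6 * K ^ 2) d n η with hsdef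
  have hn' : (0 : ℝ) < n := by exact_mod_cast hn
  set l := Real.log (1 / η) with hl
  have hl0 : 0 ≤ l := Real.log_nonneg (by rw [le_div_iff₀ hη0]; linarith)
  set δ := √(d / n) + √(l / n) with hδ
  have hδ0 : 0 ≤ δ := by positivity
  have hsδ : s = 1 - 6 * K ^ 2 * δ := rfl
  -- The factor 7/8 cancels the net loss 8/7, so that the norm of the whitened deviation is at most
  -- 6K²δ = 1 - s.
  set u := 7 / 8 * (6 * K ^ 2 * δ) with hu
  have hu0 : 0 ≤ u := by positivity
  have hu1 : u ≤ 1 := by linarith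
  have hnδ : d + l ≤ n * δ ^ 2 := by
    have e1 : √(d / n : ℝ) ^ 2 = d / n := Real.sq_sqrt (by positivity)
    have e2 : √(l / n : ℝ) ^ 2 = l / n := Real.sq_sqrt (by positivity)
    have e3 : 0 ≤ √(d / n : ℝ) * √(l / n : ℝ) := by positivity
    have e4 : δ ^ 2 = d / n + l / n + 2 * (√(d / n : ℝ) * √(l / n : ℝ)) := by
      rw [hδ, add_sq, e1, e2]; ring
    have e5 : n * (d / n + l / n : ℝ) = d + l := by field_simp
    rw [e4, ← e5]
    exact mul_le_mul_of_nonneg_left (by linarith) hn'.le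
  -- This fixes the constant 6: the exponent is (49 · 36/256) nδ², with a factor above 6, while the
  -- net requires 5.
  have hz : 5 * d + Real.log (1 / η) ≤ n * (u / K ^ 2) ^ 2 / 4 := by
    have e : n * (u / K ^ 2) ^ 2 / 4 = (49 * 36 / 256) * (n * δ ^ 2) := by
      rw [hu]; field_simp; ring
    rw [e]
    have : (0 : ℝ) ≤ d := Nat.cast_nonneg d
    linarith
  have hpd : S.PosDef := by
    refine Matrix.PosDef.of_dotProduct_mulVec_pos h.posSemidef.isHermitian fun x hx => ?_
    rw [star_trivial]
    refine lt_of_lt_of_le ?_ (lambdaMin_mul_le h.posSemidef.isHermitian x)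
    refine mul_pos hpos ?_
    have := Matrix.dotProduct_star_self_pos_iff.2 hx
    rwa [star_trivial] at this
  -- Whitening: in the coordinates `B x` the population second moment is the identity, and the net
  -- directions are `B⁻¹ v`.
  obtain ⟨B, hB⟩ : ∃ B : Matrix (Fin d) (Fin d) ℝ, S = Bᵀ * B := by
    open scoped MatrixOrder in
    obtain ⟨B, hB⟩ := CStarAlgebra.nonneg_iff_eq_star_mul_self.mp h.posSemidef.nonneg
    exact ⟨B, by simpa [Matrix.star_eq_conjTranspose] using hB⟩
  have hBu : IsUnit B.det := by
    have h1 := hpd.det_pos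
    rw [hB, Matrix.det_mul, Matrix.det_transpose] at h1
    exact isUnit_iff_ne_zero.2 fun h2 => by simp [h2] at h1
  have hq : ∀ x : Fin d → ℝ, x ⬝ᵥ S *ᵥ x = (B *ᵥ x) ⬝ᵥ (B *ᵥ x) := fun x => by
    rw [hB, ← Matrix.mulVec_mulVec, Matrix.dotProduct_mulVec, Matrix.vecMul_transpose]
  have hBinv : ∀ v : Fin d → ℝ, B *ᵥ (B⁻¹ *ᵥ v) = v := fun v => by
    rw [Matrix.mulVec_mulVec, Matrix.mul_nonsing_inv _ hBu, Matrix.one_mulVec]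
  obtain ⟨N, hN⟩ := exists_isFineNet d
  let bad : EuclideanSpace ℝ (Fin d) → Set (Fin n → EuclideanSpace ℝ (Fin d)) := fun v =>
    {A | u < |(∑ i, (∑ j, (B⁻¹ *ᵥ v) j * A i j) ^ 2) / n - (B⁻¹ *ᵥ v) ⬝ᵥ S *ᵥ (B⁻¹ *ᵥ v)|}
  have hbadm : ∀ v, MeasurableSet (bad v) := fun v =>
    measurableSet_lt measurable_const (by fun_prop)
  refine ⟨(⋃ v ∈ N, bad v)ᶜ, (N.measurableSet_biUnion fun v _ => hbadm v).compl, ?_, ?_⟩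
  · rw [compl_compl]
    refine hN.measure_biUnion_le _ bad hd hη0 hz fun v hv => ?_
    refine h.measure_direction_le hK hn _ ?_ ?_ hu0 hu1
    · rw [hq, hBinv]
      have h1 := sum_sq_mul_le v (hN.norm_le v hv)
      simpa [dotProduct, sq] using h1
    · intro h1
      by_contra hne
      have := hpd.dotProduct_mulVec_pos hne
      rw [star_trivial, h1] at this
      exact lt_irrefl _ this
  · intro D hD x
    set T := sampleSecondMoment D with hT
    set W := (B⁻¹)ᵀ * T * B⁻¹ - 1 with hW
    have hWq : ∀ v : Fin d → ℝ, v ⬝ᵥ W *ᵥ v = (B⁻¹ *ᵥ v) ⬝ᵥ T *ᵥ (B⁻¹ *ᵥ v) - v ⬝ᵥ v := fun v => by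
      rw [hW, Matrix.sub_mulVec, dotProduct_sub, Matrix.one_mulVec, ← Matrix.mulVec_mulVec,
        ← Matrix.mulVec_mulVec, Matrix.dotProduct_mulVec _ (B⁻¹)ᵀ, Matrix.vecMul_transpose]
    have hTs : Tᵀ = T := by
      ext i j
      exact sampleSecondMoment_symm D j i
    have hWs : Wᵀ = W := by
      rw [hW, Matrix.transpose_sub, Matrix.transpose_mul, Matrix.transpose_mul,
        Matrix.transpose_transpose, hTs, Matrix.transpose_one, Matrix.mul_assoc]
    have hWs' : ∀ i j, W i j = W j i := fun i j => congrFun (congrFun hWs.symm i) j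
    have hop : opNorm W ≤ 8 / 7 * u := by
      refine hN.opNorm_le hWs' fun v hv => ?_
      rw [← dotProduct_mulVec_eq_sum, hWq]
      have h1 : |(∑ i, (∑ j, (B⁻¹ *ᵥ v) j * (D i).1 j) ^ 2) / n -
          (B⁻¹ *ᵥ v) ⬝ᵥ S *ᵥ (B⁻¹ *ᵥ v)| ≤ u :=
        not_lt.1 fun hlt => hD (Set.mem_biUnion hv hlt)
      rwa [hq, hBinv, ← dotProduct_sampleSecondMoment_mulVec] at h1
    set y := B *ᵥ x with hy
    have hBx : B⁻¹ *ᵥ y = x := by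
      rw [hy, Matrix.mulVec_mulVec, Matrix.nonsing_inv_mul _ hBu, Matrix.one_mulVec]
    have h1 := hWq y
    rw [hBx] at h1
    have h2 : -(opNorm W * (y ⬝ᵥ y)) ≤ y ⬝ᵥ W *ᵥ y := by
      have h3 := abs_real_inner_le_norm
        (Matrix.toEuclideanCLM (n := Fin d) (𝕜 := ℝ) W (WithLp.toLp 2 y)) (WithLp.toLp 2 y)
      rw [inner_toEuclideanCLM] at h3
      simp only at h3
      rw [← dotProduct_mulVec_eq_sum] at h3
      have h4 := (Matrix.toEuclideanCLM (n := Fin d) (𝕜 := ℝ) W).le_opNorm (WithLp.toLp 2 y)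
      have h5 : ‖WithLp.toLp 2 y‖ * ‖WithLp.toLp 2 y‖ = y ⬝ᵥ y := by
        rw [← sq, EuclideanSpace.real_norm_sq_eq]
        simp [dotProduct, sq]
      have h6 : ‖Matrix.toEuclideanCLM (n := Fin d) (𝕜 := ℝ) W (WithLp.toLp 2 y)‖ *
          ‖WithLp.toLp 2 y‖ ≤ opNorm W * (y ⬝ᵥ y) := by
        rw [← h5, ← mul_assoc]
        exact mul_le_mul_of_nonneg_right h4 (norm_nonneg _)
      linarith [neg_abs_le (y ⬝ᵥ W *ᵥ y)]
    have hyy : 0 ≤ y ⬝ᵥ y := by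
      simp only [dotProduct]
      exact Finset.sum_nonneg fun i _ => mul_self_nonneg _
    have h7 : s * (y ⬝ᵥ y) ≤ x ⬝ᵥ T *ᵥ x := by
      have : opNorm W * (y ⬝ᵥ y) ≤ (1 - s) * (y ⬝ᵥ y) :=
        mul_le_mul_of_nonneg_right (by linarith) hyy
      linarith
    have hs1 : s ≤ 1 := by
      have : 0 ≤ 6 * K ^ 2 * δ := by positivity
      linarith
    calc lambdaMin S * s ^ 2 * (x ⬝ᵥ x) = s ^ 2 * (lambdaMin S * (x ⬝ᵥ x)) := by ring
      _ ≤ s ^ 2 * (y ⬝ᵥ y) := by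
          rw [← hq]
          exact mul_le_mul_of_nonneg_left (lambdaMin_mul_le h.posSemidef.isHermitian x) (sq_nonneg _)
      _ ≤ s * (y ⬝ᵥ y) := by
          -- The argument yields the factor s; since 0 ≤ s ≤ 1 it dominates s².
          refine mul_le_mul_of_nonneg_right ?_ hyy
          nlinarith
      _ ≤ _ := h7

end DPRidge

end

noncomputable section

/-! ### Bounds for the privacy noise and for the response errors -/

namespace DPRidge

open scoped NNReal ENNReal Matrix

/-- Grouping ordered pairs by their unordered pair turns the quadratic form of the symmetric noise
into a linear functional of its independent entries. -/
lemma sum_sym2_mul_eq {d : ℕ} (f : Fin d × Fin d → ℝ) (w : Sym2 (Fin d) → ℝ) :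
    ∑ p, (∑ q with s(q.1, q.2) = p, f q) * w p = ∑ i, ∑ j, f (i, j) * w s(i, j) := by
  rw [← Fintype.sum_prod_type' (f := fun i j => f (i, j) * w s(i, j)),
    ← Finset.sum_fiberwise Finset.univ (fun q : Fin d × Fin d => s(q.1, q.2))]
  refine Finset.sum_congr rfl fun p _ => ?_
  rw [Finset.sum_mul]
  refine Finset.sum_congr rfl fun q hq => ?_
  rw [(Finset.mem_filter.1 hq).2]

/-- An unordered pair has at most two orderings. The resulting 2 is the source of the √2 in front of
`sigma₁` in the norm bound. -/
lemma sum_sym2_sq_le {d : ℕ} (f : Fin d × Fin d → ℝ) :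
    ∑ p, (∑ q with s(q.1, q.2) = p, f q) ^ 2 ≤ 2 * ∑ i, ∑ j, f (i, j) ^ 2 := by
  rw [← Fintype.sum_prod_type' (f := fun i j => f (i, j) ^ 2),
    ← Finset.sum_fiberwise Finset.univ (fun q : Fin d × Fin d => s(q.1, q.2)), Finset.mul_sum]
  refine Finset.sum_le_sum fun p _ => sq_sum_le_card_mul_sum_sq.trans ?_
  refine mul_le_mul_of_nonneg_right ?_ (Finset.sum_nonneg fun _ _ => sq_nonneg _)
  induction p with | _ a b =>
  have hsub : (Finset.univ.filter fun q : Fin d × Fin d => s(q.1, q.2) = s(a, b)) ⊆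
      {(a, b), (b, a)} := by
    intro q hq
    have h := (Finset.mem_filter.1 hq).2
    rw [Sym2.eq_iff] at h
    simp only [Finset.mem_insert, Finset.mem_singleton, Prod.ext_iff]
    exact h
  exact_mod_cast (Finset.card_le_card hsub).trans Finset.card_le_two

/-- With high probability the privacy noises are of order `σ₁ t` in operator norm and of order
`σ₂ t` in Euclidean norm. -/
lemma exists_privacyNoise_good {d : ℕ} (hd : 0 < d) (n : ℕ) (S : Matrix (Fin d) (Fin d) ℝ)
    (β : EuclideanSpace ℝ (Fin d)) {η μ t : ℝ} (hη : 0 < η) (h1 : 0 ≤ sigma₁ n S η μ)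
    (h2 : 0 ≤ sigma₂ n S β η μ) (ht : 0 ≤ t) (htz : 5 * d + Real.log (1 / η) ≤ t ^ 2 / 2) :
    ∃ good : Set ((Fin d → Fin d → ℝ) × (Fin d → ℝ)), MeasurableSet good ∧
      privacyNoise n S β η μ goodᶜ ≤ ENNReal.ofReal (2 * η) ∧
      ∀ w ∈ good, opNorm (Matrix.of w.1) ≤ 8 / 7 * (√2 * sigma₁ n S η μ * t) ∧
        ‖WithLp.toLp 2 w.2‖ ≤ 16 / 15 * (sigma₂ n S β η μ * t) := by
  obtain ⟨N, hN⟩ := exists_isFineNet d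
  set r₁ := √2 * sigma₁ n S η μ with hr₁
  set r₂ := sigma₂ n S β η μ with hr₂
  have hr₁0 : 0 ≤ r₁ := by positivity
  -- Symmetry is made part of the event because the net bound for the operator norm needs it; every
  -- matrix built from unordered pairs satisfies it.
  let good : Set ((Fin d → Fin d → ℝ) × (Fin d → ℝ)) :=
    (⋂ i, ⋂ j, {w | w.1 i j = w.1 j i}) ∩ ⋂ v ∈ N,
      ({w | |∑ i, ∑ j, v i * v j * w.1 i j| ≤ r₁ * t} ∩ {w | |∑ i, v i * w.2 i| ≤ r₂ * t})
  have hgm : MeasurableSet good := by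
    refine (MeasurableSet.iInter fun i => MeasurableSet.iInter fun j =>
      measurableSet_eq_fun (by fun_prop) (by fun_prop)).inter
      (Finset.measurableSet_biInter _ fun v _ => ?_)
    exact (measurableSet_le (by fun_prop) measurable_const).inter
      (measurableSet_le (by fun_prop) measurable_const)
  refine ⟨good, hgm, ?_, ?_⟩
  · rw [privacyNoise_eq_map, Measure.map_apply (measurable_noisePair d) hgm.compl]
    set V : Sym2 (Fin d) ⊕ Fin d → ℝ≥0 := Sum.elim
      (fun _ : Sym2 (Fin d) => (sigma₁ n S η μ ^ 2).toNNReal)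
      (fun _ : Fin d => (sigma₂ n S β η μ ^ 2).toNNReal) with hV
    let a : EuclideanSpace ℝ (Fin d) → Sym2 (Fin d) → ℝ := fun v p =>
      ∑ q : Fin d × Fin d with s(q.1, q.2) = p, v q.1 * v q.2
    let A : EuclideanSpace ℝ (Fin d) → Set (Sym2 (Fin d) ⊕ Fin d → ℝ) := fun v =>
      {x | r₁ * t < |∑ i, Sum.elim (a v) (fun _ => 0) i * x i|}
    let B : EuclideanSpace ℝ (Fin d) → Set (Sym2 (Fin d) ⊕ Fin d → ℝ) := fun v =>
      {x | r₂ * t < |∑ i, Sum.elim (fun _ => 0) v i * x i|}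
    have hsub : noisePair d ⁻¹' goodᶜ ⊆ (⋃ v ∈ N, A v) ∪ ⋃ v ∈ N, B v := by
      intro x hx
      by_contra hcon
      refine hx ⟨?_, ?_⟩
      · simp only [Set.mem_iInter]
        intro i j
        change x (Sum.inl s(i, j)) = x (Sum.inl s(j, i))
        rw [Sym2.eq_swap]
      · refine Set.mem_iInter₂.2 fun v hv => ⟨?_, ?_⟩
        · by_contra hle
          have hlt : r₁ * t < |∑ i, ∑ j, v i * v j * x (Sum.inl s(i, j))| := not_le.1 hle
          refine hcon (Or.inl (Set.mem_biUnion hv ?_))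
          change r₁ * t < |∑ i, Sum.elim (a v) (fun _ => 0) i * x i|
          rw [Fintype.sum_sum_type]
          simp only [Sum.elim_inl, Sum.elim_inr, zero_mul, Finset.sum_const_zero, add_zero, a]
          rw [sum_sym2_mul_eq (fun q => v q.1 * v q.2) (fun p => x (Sum.inl p))]
          exact hlt
        · by_contra hle
          have hlt : r₂ * t < |∑ i, v i * x (Sum.inr i)| := not_le.1 hle
          refine hcon (Or.inr (Set.mem_biUnion hv ?_))
          change r₂ * t < |∑ i, Sum.elim (fun _ => 0) v i * x i|
          rw [Fintype.sum_sum_type]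
          simp only [Sum.elim_inl, Sum.elim_inr, zero_mul, Finset.sum_const_zero, zero_add]
          exact hlt
    refine (measure_mono hsub).trans ((measure_union_le _ _).trans ?_)
    rw [two_mul, ENNReal.ofReal_add hη.le hη.le]
    have hexp : -t ^ 2 / 2 = -(t ^ 2 / 2) := by ring
    refine add_le_add (hN.measure_biUnion_le _ A hd hη htz fun v hv => ?_)
      (hN.measure_biUnion_le _ B hd hη htz fun v hv => ?_)
    · rw [← hexp]
      refine pi_gaussianReal_abs_sum_gt_le V _ hr₁0 ht ?_
      rw [Fintype.sum_sum_type]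
      simp only [Sum.elim_inl, Sum.elim_inr, hV, Real.coe_toNNReal _ (sq_nonneg _)]
      rw [← Finset.sum_mul, hr₁, mul_pow, Real.sq_sqrt zero_le_two]
      have h3 := sum_sym2_sq_le (fun q : Fin d × Fin d => v q.1 * v q.2)
      have h4 : ∑ i, ∑ j, (v i * v j) ^ 2 = (∑ i, v i ^ 2) ^ 2 := by
        rw [sq (∑ i, v i ^ 2), Finset.sum_mul_sum]
        simp_rw [mul_pow]
      have h5 := sum_sq_mul_le v (hN.norm_le v hv)
      have h6 : 0 ≤ ∑ i, v i ^ 2 := Finset.sum_nonneg fun _ _ => sq_nonneg _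
      simp only at h3
      rw [h4] at h3
      have h7 : ∑ p, a v p ^ 2 ≤ 2 := h3.trans (by nlinarith)
      norm_num
      exact mul_le_mul_of_nonneg_right h7 (sq_nonneg _)
    · rw [← hexp]
      refine pi_gaussianReal_abs_sum_gt_le V _ h2 ht ?_
      rw [Fintype.sum_sum_type]
      simp only [Sum.elim_inl, Sum.elim_inr, hV, Real.coe_toNNReal _ (sq_nonneg _)]
      have h5 := sum_sq_mul_le v (hN.norm_le v hv)
      norm_num
      rw [← Finset.sum_mul, ← hr₂]
      rw [one_pow] at h5
      nlinarith [sq_nonneg r₂]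
  · rintro w ⟨hw1, hw2⟩
    simp only [Set.mem_iInter] at hw1
    have hw2' := fun v hv => Set.mem_iInter₂.1 hw2 v hv
    exact ⟨hN.opNorm_le hw1 fun v hv => (hw2' v hv).1,
      hN.norm_le_of_inner_le fun v hv => (hw2' v hv).2⟩

/-! ### Coercive linear systems and their perturbation -/

section Coercive

variable {d : ℕ} {M : Matrix (Fin d) (Fin d) ℝ} {m : ℝ}

lemma dotProduct_self_eq_norm_sq (x : Fin d → ℝ) : x ⬝ᵥ x = ‖WithLp.toLp 2 x‖ ^ 2 := by
  rw [EuclideanSpace.real_norm_sq_eq]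
  simp [dotProduct, sq]

lemma dotProduct_le_norm_mul_norm (x y : Fin d → ℝ) :
    |x ⬝ᵥ y| ≤ ‖WithLp.toLp 2 x‖ * ‖WithLp.toLp 2 y‖ := by
  have h := abs_real_inner_le_norm (WithLp.toLp 2 x : EuclideanSpace ℝ (Fin d)) (WithLp.toLp 2 y)
  rw [PiLp.inner_apply] at h
  simpa [dotProduct, mul_comm] using h

lemma norm_toLp_mulVec_le (M : Matrix (Fin d) (Fin d) ℝ) (x : Fin d → ℝ) :
    ‖WithLp.toLp 2 (M *ᵥ x)‖ ≤ opNorm M * ‖WithLp.toLp 2 x‖ := by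
  have h := (Matrix.toEuclideanCLM (n := Fin d) (𝕜 := ℝ) M).le_opNorm (WithLp.toLp 2 x)
  rwa [Matrix.toEuclideanCLM_toLp] at h

lemma abs_dotProduct_mulVec_le (M : Matrix (Fin d) (Fin d) ℝ) (x : Fin d → ℝ) :
    |x ⬝ᵥ M *ᵥ x| ≤ opNorm M * (x ⬝ᵥ x) := by
  refine (dotProduct_le_norm_mul_norm _ _).trans ?_
  rw [dotProduct_self_eq_norm_sq]
  nlinarith [norm_toLp_mulVec_le M x, norm_nonneg (WithLp.toLp 2 x)]

/-- Cauchy–Schwarz applied to the coercivity inequality, then division by the norm of `x`. -/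
lemma mul_norm_le_norm_mulVec (hM : ∀ x, m * (x ⬝ᵥ x) ≤ x ⬝ᵥ M *ᵥ x) (x : Fin d → ℝ) :
    m * ‖WithLp.toLp 2 x‖ ≤ ‖WithLp.toLp 2 (M *ᵥ x)‖ := by
  rcases (norm_nonneg (WithLp.toLp 2 x)).eq_or_lt with h0 | hpos
  · rw [← h0, mul_zero]; positivity
  · have h1 := (hM x).trans ((le_abs_self _).trans (dotProduct_le_norm_mul_norm _ _))
    rw [dotProduct_self_eq_norm_sq] at h1
    nlinarith

lemma isUnit_det_of_coercive (hm : 0 < m) (hM : ∀ x, m * (x ⬝ᵥ x) ≤ x ⬝ᵥ M *ᵥ x) :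
    IsUnit M.det := by
  rw [← Matrix.isUnit_iff_isUnit_det, ← Matrix.mulVec_injective_iff_isUnit]
  intro x y hxy
  have h := mul_norm_le_norm_mulVec hM (x - y)
  rw [Matrix.mulVec_sub, show M *ᵥ x = M *ᵥ y from hxy, sub_self, WithLp.toLp_zero, norm_zero] at h
  have h1 : ‖WithLp.toLp 2 (x - y)‖ = 0 := le_antisymm (by nlinarith) (norm_nonneg _)
  have h2 := (WithLp.toLp_eq_zero 2).1 (norm_eq_zero.1 h1)
  exact sub_eq_zero.1 h2

lemma norm_inv_mulVec_le (hm : 0 < m) (hM : ∀ x, m * (x ⬝ᵥ x) ≤ x ⬝ᵥ M *ᵥ x) (y : Fin d → ℝ) :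
    ‖WithLp.toLp 2 (M⁻¹ *ᵥ y)‖ ≤ ‖WithLp.toLp 2 y‖ / m := by
  have h := mul_norm_le_norm_mulVec hM (M⁻¹ *ᵥ y)
  rw [Matrix.mulVec_mulVec, Matrix.mul_nonsing_inv _ (isUnit_det_of_coercive hm hM),
    Matrix.one_mulVec] at h
  rw [le_div_iff₀ hm]
  linarith

/-- Perturbation of the solution of a coercive linear system. -/
lemma norm_inv_add_mulVec_sub_le (hm : 0 < m) (hM : ∀ x, m * (x ⬝ᵥ x) ≤ x ⬝ᵥ M *ᵥ x)
    {G : Matrix (Fin d) (Fin d) ℝ} (hG : opNorm G ≤ 6 / 7 * m) (b g : Fin d → ℝ) :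
    ‖WithLp.toLp 2 ((M + G)⁻¹ *ᵥ (b + g)) - WithLp.toLp 2 (M⁻¹ *ᵥ b)‖ ≤
      7 / m * (‖WithLp.toLp 2 g‖ + opNorm G * ‖WithLp.toLp 2 (M⁻¹ *ᵥ b)‖) := by
  have hMG : ∀ x, m / 7 * (x ⬝ᵥ x) ≤ x ⬝ᵥ (M + G) *ᵥ x := by
    intro x
    rw [Matrix.add_mulVec, dotProduct_add]
    have h1 := (abs_le.1 (abs_dotProduct_mulVec_le G x)).1
    have h2 : 0 ≤ x ⬝ᵥ x := by rw [dotProduct_self_eq_norm_sq]; positivity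
    nlinarith [hM x, mul_le_mul_of_nonneg_right hG h2]
  have hm7 : 0 < m / 7 := by positivity
  have hu := isUnit_det_of_coercive hm7 hMG
  have hu' := isUnit_det_of_coercive hm hM
  -- The resolvent identity keeps the unperturbed solution on the right, so only its norm enters the
  -- bound, not that of the noisy right-hand side.
  have e : (M + G)⁻¹ *ᵥ (b + g) - M⁻¹ *ᵥ b = (M + G)⁻¹ *ᵥ (g - G *ᵥ (M⁻¹ *ᵥ b)) := by
    have e1 : M⁻¹ *ᵥ b = (M + G)⁻¹ *ᵥ ((M + G) *ᵥ (M⁻¹ *ᵥ b)) := by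
      rw [Matrix.mulVec_mulVec _ (M + G)⁻¹, Matrix.nonsing_inv_mul _ hu, Matrix.one_mulVec]
    have e2 : M *ᵥ (M⁻¹ *ᵥ b) = b := by
      rw [Matrix.mulVec_mulVec, Matrix.mul_nonsing_inv _ hu', Matrix.one_mulVec]
    conv_lhs => rw [e1]
    rw [← Matrix.mulVec_sub, Matrix.add_mulVec, e2]
    congr 1
    abel
  rw [← WithLp.toLp_sub, e]
  refine (norm_inv_mulVec_le hm7 hMG _).trans ?_
  rw [div_div_eq_mul_div, mul_comm, mul_div_right_comm]
  gcongr
  rw [WithLp.toLp_sub]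
  refine (norm_sub_le _ _).trans ?_
  gcongr
  exact norm_toLp_mulVec_le _ _

end Coercive

/-- The second moment of the covariates plus the ridge. -/
def ridgeMatrix {d n : ℕ} (lam : ℝ) (A : Fin n → EuclideanSpace ℝ (Fin d)) :
    Matrix (Fin d) (Fin d) ℝ :=
  sampleSecondMoment (fun i => (A i, 0)) + lam • (1 : Matrix (Fin d) (Fin d) ℝ)

/-! ### Contribution of the response errors -/

section Errors

variable {d n : ℕ} {lam m : ℝ}

lemma ridgeMatrix_transpose (A : Fin n → EuclideanSpace ℝ (Fin d)) :
    (ridgeMatrix lam A)ᵀ = ridgeMatrix lam A := by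
  have h : (sampleSecondMoment fun i => (A i, (0 : ℝ)))ᵀ = sampleSecondMoment fun i => (A i, 0) := by
    ext i j
    exact sampleSecondMoment_symm _ j i
  rw [ridgeMatrix, Matrix.transpose_add, Matrix.transpose_smul, Matrix.transpose_one, h]

/-- The cross moment of the covariates and the errors. -/
def errorMoment (z : (Fin n → EuclideanSpace ℝ (Fin d)) × (Fin n → ℝ)) : Fin d → ℝ :=
  fun j => (∑ i, z.1 i j * z.2 i) / n

lemma dotProduct_inv_mulVec_errorMoment (z : (Fin n → EuclideanSpace ℝ (Fin d)) × (Fin n → ℝ))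
    (M : Matrix (Fin d) (Fin d) ℝ) (v : Fin d → ℝ) :
    v ⬝ᵥ M *ᵥ errorMoment z = ∑ i, ((∑ j, (v ᵥ* M) j * z.1 i j) / n) * z.2 i := by
  rw [Matrix.dotProduct_mulVec]
  simp only [dotProduct, errorMoment, Finset.sum_div, Finset.mul_sum, Finset.sum_mul]
  rw [Finset.sum_comm]
  exact Finset.sum_congr rfl fun i _ => Finset.sum_congr rfl fun j _ => by ring

/-- With w = M⁻¹v the sum is wᵀTw/n, where T is the sample second moment. Since λ ≥ 0, wᵀTw ≤ wᵀMw =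
w·v. Coercivity and Cauchy–Schwarz give m(w·v)² ≤ m‖w‖² ≤ w·v, hence w·v ≤ 1/m. Only one power of
1/m is lost, half of what a bound through ‖M⁻¹‖² would lose. -/
lemma sum_sq_ridge_coeff_le (hn : 0 < n) (hlam : 0 ≤ lam) (hm : 0 < m)
    {A : Fin n → EuclideanSpace ℝ (Fin d)}
    (hM : ∀ x, m * (x ⬝ᵥ x) ≤ x ⬝ᵥ ridgeMatrix lam A *ᵥ x) {v : Fin d → ℝ} (hv : v ⬝ᵥ v ≤ 1) :
    ∑ i, ((∑ j, (v ᵥ* (ridgeMatrix lam A)⁻¹) j * A i j) / n) ^ 2 ≤ 1 / (n * m) := by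
  set M := ridgeMatrix lam A with hMdef
  have hn' : (0 : ℝ) < n := by exact_mod_cast hn
  have hu := isUnit_det_of_coercive hm hM
  set w := v ᵥ* M⁻¹ with hw
  have hMw : M *ᵥ w = v := by
    have : w ᵥ* M = v := by
      rw [hw, Matrix.vecMul_vecMul, Matrix.nonsing_inv_mul _ hu, Matrix.vecMul_one]
    rwa [← Matrix.mulVec_transpose, ridgeMatrix_transpose] at this
  have h1 := dotProduct_sampleSecondMoment_mulVec (fun i => (A i, (0 : ℝ))) w
  have hww : 0 ≤ w ⬝ᵥ w := by rw [dotProduct_self_eq_norm_sq]; positivity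
  have h2 : w ⬝ᵥ M *ᵥ w = w ⬝ᵥ sampleSecondMoment (fun i => (A i, (0 : ℝ))) *ᵥ w +
      lam * (w ⬝ᵥ w) := by
    rw [hMdef, ridgeMatrix, Matrix.add_mulVec, dotProduct_add, Matrix.smul_mulVec,
      Matrix.one_mulVec, dotProduct_smul, smul_eq_mul]
  have h3 := hM w
  rw [hMw] at h2 h3
  have h4 : w ⬝ᵥ v ≤ 1 / m := by
    have h5 := dotProduct_le_norm_mul_norm w v
    have h6 : (w ⬝ᵥ v) ^ 2 ≤ w ⬝ᵥ w := by
      rw [← sq_abs]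
      calc |w ⬝ᵥ v| ^ 2 ≤ (‖WithLp.toLp 2 w‖ * ‖WithLp.toLp 2 v‖) ^ 2 := by gcongr
        _ = (w ⬝ᵥ w) * (v ⬝ᵥ v) := by
          rw [mul_pow, dotProduct_self_eq_norm_sq, dotProduct_self_eq_norm_sq]
        _ ≤ w ⬝ᵥ w := by nlinarith
    rw [le_div_iff₀ hm]
    rcases le_or_gt (w ⬝ᵥ v) 0 with hneg | hpos
    · nlinarith
    · have : m * (w ⬝ᵥ v) ^ 2 ≤ w ⬝ᵥ v := (mul_le_mul_of_nonneg_left h6 hm.le).trans h3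
      nlinarith
  have h7 : ∑ i, ((∑ j, w j * A i j) / n) ^ 2 =
      (w ⬝ᵥ sampleSecondMoment (fun i => (A i, (0 : ℝ))) *ᵥ w) / n := by
    rw [h1, div_div, Finset.sum_div]
    exact Finset.sum_congr rfl fun i _ => by rw [div_pow, sq (n : ℝ)]
  rw [h7, mul_comm (n : ℝ), ← div_div]
  gcongr
  nlinarith [mul_nonneg hlam hww]

lemma measurable_ridgeMatrix_inv (lam : ℝ) (i j : Fin d) :
    Measurable fun A : Fin n → EuclideanSpace ℝ (Fin d) => (ridgeMatrix lam A)⁻¹ i j := by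
  refine measurable_matrix_inv (fun i j => ?_) i j
  simp only [ridgeMatrix, sampleSecondMoment, Matrix.add_apply, Matrix.of_apply]
  fun_prop

lemma measurable_ridge_error (lam : ℝ) (v : Fin d → ℝ) :
    Measurable fun z : (Fin n → EuclideanSpace ℝ (Fin d)) × (Fin n → ℝ) =>
      ∑ i, ((∑ j, (v ᵥ* (ridgeMatrix lam z.1)⁻¹) j * z.1 i j) / n) * z.2 i := by
  have h1 : ∀ j, Measurable fun z : (Fin n → EuclideanSpace ℝ (Fin d)) × (Fin n → ℝ) =>
      (v ᵥ* (ridgeMatrix lam z.1)⁻¹) j := fun j => by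
    simp only [Matrix.vecMul, dotProduct]
    exact Finset.measurable_sum _ fun i _ =>
      ((measurable_ridgeMatrix_inv lam i j).comp measurable_fst).const_mul _
  refine Finset.measurable_sum _ fun i _ => Measurable.mul ?_ (by fun_prop)
  exact (Finset.measurable_sum _ fun j _ => (h1 j).mul (by fun_prop)).div_const _

instance (n : ℕ) (σ : ℝ) : IsProbabilityMeasure (gaussianVector n σ) := by
  unfold gaussianVector
  infer_instance

/-- With high probability, the contribution of the response errors to the ridge estimator is
small. -/
lemma exists_modelLaw_error_good (hd : 0 < d) (hn : 0 < n) (hlam : 0 ≤ lam) (hm : 0 < m)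
    (ν : Measure (EuclideanSpace ℝ (Fin d))) [IsProbabilityMeasure ν] {σ η t : ℝ} (hσ : 0 ≤ σ)
    (hη : 0 < η) (ht : 0 ≤ t) (htz : 5 * d + Real.log (1 / η) ≤ t ^ 2 / 2)
    {good : Set (Fin n → EuclideanSpace ℝ (Fin d))} (hgood : MeasurableSet good)
    (hM : ∀ A ∈ good, ∀ x, m * (x ⬝ᵥ x) ≤ x ⬝ᵥ ridgeMatrix lam A *ᵥ x) :
    ∃ bad : Set ((Fin n → EuclideanSpace ℝ (Fin d)) × (Fin n → ℝ)), MeasurableSet bad ∧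
      modelLaw n ν σ bad ≤ ENNReal.ofReal η ∧
      ∀ z, z.1 ∈ good → z ∉ bad →
        ‖WithLp.toLp 2 ((ridgeMatrix lam z.1)⁻¹ *ᵥ errorMoment z)‖ ≤
          16 / 15 * (σ / √(n * m) * t) := by
  obtain ⟨N, hN⟩ := exists_isFineNet d
  have hn' : (0 : ℝ) < n := by exact_mod_cast hn
  set r := σ / √(n * m) with hr
  have hr0 : 0 ≤ r := by positivity
  let B : EuclideanSpace ℝ (Fin d) → Set ((Fin n → EuclideanSpace ℝ (Fin d)) × (Fin n → ℝ)) :=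
    fun v => {z | r * t < |∑ i, ((∑ j, (v ᵥ* (ridgeMatrix lam z.1)⁻¹) j * z.1 i j) / n) * z.2 i|}
  have hBm : ∀ v, MeasurableSet (B v) := fun v =>
    measurableSet_lt measurable_const (measurable_ridge_error lam v).abs
  -- By Fubini the covariates are frozen. Over covariates outside `good` the variance is
  -- uncontrolled, so the bad event is restricted to have empty fibres there.
  refine ⟨(Prod.fst ⁻¹' good) ∩ ⋃ v ∈ N, B v,
    (measurable_fst hgood).inter (N.measurableSet_biUnion fun v _ => hBm v), ?_, ?_⟩
  · rw [modelLaw, Measure.prod_apply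
      ((measurable_fst hgood).inter (N.measurableSet_biUnion fun v _ => hBm v))]
    calc _ ≤ ∫⁻ _A, ENNReal.ofReal η ∂(Measure.pi fun _ : Fin n => ν) :=
          lintegral_mono fun A => ?_
      _ = ENNReal.ofReal η := by simp
    by_cases hA : A ∈ good
    · refine (measure_mono (t := ⋃ v ∈ N, Prod.mk A ⁻¹' B v) fun e he => ?_).trans ?_
      · have := he.2
        simp only [Set.mem_iUnion] at this ⊢
        exact this
      · refine hN.measure_biUnion_le _ _ hd hη htz fun v hv => ?_
        have hexp : -t ^ 2 / 2 = -(t ^ 2 / 2) := by ring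
        rw [← hexp]
        refine pi_gaussianReal_abs_sum_gt_le (fun _ => (σ ^ 2).toNNReal)
          (fun i => (∑ j, (v ᵥ* (ridgeMatrix lam A)⁻¹) j * A i j) / n) hr0 ht ?_
        simp only [Real.coe_toNNReal _ (sq_nonneg _)]
        rw [← Finset.sum_mul, hr, div_pow, Real.sq_sqrt (by positivity)]
        have hv1 : (v : Fin d → ℝ) ⬝ᵥ v ≤ 1 := by
          rw [dotProduct_self_eq_norm_sq]
          have := hN.norm_le v hv
          simpa using this
        have h := sum_sq_ridge_coeff_le hn hlam hm (hM A hA) hv1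
        calc _ ≤ 1 / (n * m) * σ ^ 2 := mul_le_mul_of_nonneg_right h (sq_nonneg _)
          _ = _ := by ring
    · have : Prod.mk A ⁻¹' ((Prod.fst ⁻¹' good) ∩ ⋃ v ∈ N, B v) = ∅ := by
        ext e
        simp [hA]
      rw [this, measure_empty]
      exact zero_le
  · intro z hz hzb
    refine hN.norm_le_of_inner_le fun v hv => not_lt.1 fun hlt =>
      hzb ⟨hz, Set.mem_biUnion hv ?_⟩
    change r * t < _
    rw [← dotProduct_inv_mulVec_errorMoment]
    exact hlt

end Errors

end DPRidge

end

noncomputable section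

/-! ### Accuracy -/

namespace DPRidge

open scoped NNReal ENNReal Matrix

lemma truncateData_eq_self {d n : ℕ} {S : Matrix (Fin d) (Fin d) ℝ} {β : EuclideanSpace ℝ (Fin d)}
    {η : ℝ} {D : Fin n → EuclideanSpace ℝ (Fin d) × ℝ}
    (h : ∀ i, ‖(D i).1‖ ≤ radius n S η ∧ |(D i).2| ≤ radius n S η * ‖β‖) :
    truncateData S β η D = D := by
  funext i
  have h2 : ‖(D i).2‖ ≤ radius n S η * ‖β‖ := (h i).2
  simp only [truncateData, truncate, if_pos (h i).1, if_pos h2]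

lemma lambdaMin_le_opNorm {d : ℕ} (hd : 0 < d) {S : Matrix (Fin d) (Fin d) ℝ}
    (hS : S.IsHermitian) : lambdaMin S ≤ opNorm S := by
  have h := (lambdaMin_mul_le hS (Pi.single ⟨0, hd⟩ 1)).trans
    ((le_abs_self _).trans (abs_dotProduct_mulVec_le S (Pi.single ⟨0, hd⟩ 1)))
  simpa using h

lemma sampleCrossMoment_dataset {d n : ℕ} (β : EuclideanSpace ℝ (Fin d))
    (z : (Fin n → EuclideanSpace ℝ (Fin d)) × (Fin n → ℝ)) :
    sampleCrossMoment (dataset β z) =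
      sampleSecondMoment (fun i => (z.1 i, (0 : ℝ))) *ᵥ β + errorMoment z := by
  ext k
  simp only [sampleCrossMoment, dataset, Pi.add_apply, errorMoment, Matrix.mulVec, dotProduct,
    sampleSecondMoment, Matrix.of_apply, mul_add, Finset.sum_add_distrib, add_div,
    Finset.mul_sum, Finset.sum_div, Finset.sum_mul]
  congr 1
  rw [Finset.sum_comm]
  exact Finset.sum_congr rfl fun i _ => Finset.sum_congr rfl fun j _ => by ring

/-- Without errors the ridge estimator is β - λM⁻¹β, and λ ≤ m makes the shrinkage term at most ‖β‖.
-/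
lemma norm_ridge_le {d n : ℕ} {lam m : ℝ} (hlam : 0 ≤ lam) (hm : 0 < m) (hlm : lam ≤ m)
    (β : EuclideanSpace ℝ (Fin d)) (z : (Fin n → EuclideanSpace ℝ (Fin d)) × (Fin n → ℝ))
    (hM : ∀ x, m * (x ⬝ᵥ x) ≤ x ⬝ᵥ ridgeMatrix lam z.1 *ᵥ x) :
    ‖WithLp.toLp 2 ((ridgeMatrix lam z.1)⁻¹ *ᵥ sampleCrossMoment (dataset β z))‖ ≤
      2 * ‖β‖ + ‖WithLp.toLp 2 ((ridgeMatrix lam z.1)⁻¹ *ᵥ errorMoment z)‖ := by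
  set M := ridgeMatrix lam z.1 with hMdef
  have hu := isUnit_det_of_coercive hm hM
  have e : sampleSecondMoment (fun i => (z.1 i, (0 : ℝ))) *ᵥ (β : Fin d → ℝ) =
      M *ᵥ β - lam • (β : Fin d → ℝ) := by
    rw [hMdef, ridgeMatrix, Matrix.add_mulVec, Matrix.smul_mulVec, Matrix.one_mulVec,
      add_sub_cancel_right]
  rw [sampleCrossMoment_dataset, e, Matrix.mulVec_add, Matrix.mulVec_sub, Matrix.mulVec_mulVec,
    Matrix.nonsing_inv_mul _ hu, Matrix.one_mulVec, Matrix.mulVec_smul, WithLp.toLp_add,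
    WithLp.toLp_sub, WithLp.toLp_smul]
  have h1 : ‖lam • WithLp.toLp 2 (M⁻¹ *ᵥ (β : Fin d → ℝ))‖ ≤ ‖β‖ := by
    rw [norm_smul, Real.norm_of_nonneg hlam]
    have h2 := norm_inv_mulVec_le hm hM β
    rw [WithLp.toLp_ofLp] at h2
    calc lam * ‖WithLp.toLp 2 (M⁻¹ *ᵥ (β : Fin d → ℝ))‖ ≤ m * (‖β‖ / m) := by gcongr
      _ = ‖β‖ := by field_simp
  refine (norm_add_le _ _).trans ?_
  gcongr
  refine (norm_sub_le _ _).trans ?_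
  rw [WithLp.toLp_ofLp]
  linarith

lemma noiseOrder_eq {d : ℕ} (hd : 0 < d) (n : ℕ) (S : Matrix (Fin d) (Fin d) ℝ) (η μ : ℝ) :
    sigma₁ n S η μ * √(d * Real.log (2 * d / η)) = 2 * noiseOrder n S η μ := by
  have hd' : (0 : ℝ) < d := by exact_mod_cast hd
  have e : (d : ℝ) ^ 3 * Real.log (2 * d / η) = d ^ 2 * (d * Real.log (2 * d / η)) := by ring
  rw [noiseOrder, e, Real.sqrt_mul (sq_nonneg _), Real.sqrt_sq hd'.le, sigma₁]
  field_simp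

/-- The numerical estimate that turns the perturbation bound into the stated rate. -/
lemma rate_le {τ m b B Λ κ ρ q : ℝ} (hτ : 0 ≤ τ) (hm : 0 < m) (hκ : 0 ≤ κ) (hρ : 0 ≤ ρ)
    (hB : 0 ≤ B) (hmΛ : m ≤ (1 + κ) * Λ) (hb : b ≤ 2 * B + 5 * (ρ * (√Λ * B) / √m))
    (hq0 : 0 < q) (hq : q ≤ m ^ 2) :
    7 / m * (4 * (τ * B) + 5 * τ * b) ≤ (7 * (14 + 25 * ρ) * (1 + κ)) * (τ * (Λ * B) / q) := by
  have hΛ : 0 < Λ := by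
    by_contra h
    nlinarith [not_lt.1 h]
  -- The ratio (1 + κ)Λ/m is at least 1, so it dominates both the constant term and the square root
  -- coming from the errors.
  have h1 : √Λ / √m ≤ (1 + κ) * Λ / m := by
    rw [div_le_div_iff₀ (Real.sqrt_pos.2 hm) hm]
    have e1 : m = √m * √m := (Real.mul_self_sqrt hm.le).symm
    have e2 : Λ = √Λ * √Λ := (Real.mul_self_sqrt hΛ.le).symm
    have h2 : √m ≤ (1 + κ) * √Λ := by
      refine Real.sqrt_le_iff.2 ⟨by positivity, ?_⟩
      rw [mul_pow, Real.sq_sqrt hΛ.le]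
      nlinarith [mul_nonneg hκ hΛ.le]
    calc √Λ * m = √Λ * √m * √m := by rw [mul_assoc, ← e1]
      _ ≤ √Λ * ((1 + κ) * √Λ) * √m := by gcongr
      _ = (1 + κ) * (√Λ * √Λ) * √m := by ring
      _ = _ := by rw [← e2]
  have h3 : 1 ≤ (1 + κ) * Λ / m := by rw [le_div_iff₀ hm]; linarith
  have h4 : 4 * (τ * B) + 5 * τ * b ≤ τ * B * (14 + 25 * ρ) * ((1 + κ) * Λ / m) := by
    have h5 : ρ * (√Λ * B) / √m = ρ * B * (√Λ / √m) := by ring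
    have h6 : ρ * B * (√Λ / √m) ≤ ρ * B * ((1 + κ) * Λ / m) := by gcongr
    have h7 : τ * b ≤ τ * (2 * B + 5 * (ρ * B * ((1 + κ) * Λ / m))) :=
      mul_le_mul_of_nonneg_left (by rw [h5] at hb; linarith) hτ
    have h8 : τ * B * 1 ≤ τ * B * ((1 + κ) * Λ / m) := by gcongr
    nlinarith
  calc 7 / m * (4 * (τ * B) + 5 * τ * b)
      ≤ 7 / m * (τ * B * (14 + 25 * ρ) * ((1 + κ) * Λ / m)) := by gcongr
    _ = (7 * (14 + 25 * ρ) * (1 + κ)) * (τ * (Λ * B) / m ^ 2) := by field_simp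
    _ ≤ _ := by gcongr

/-- The estimation error for given data and noises, under bounds for the noises. -/
lemma norm_dpRidge_sub_ridge_le {d n : ℕ} {S : Matrix (Fin d) (Fin d) ℝ}
    {β : EuclideanSpace ℝ (Fin d)} {κ ρ lam η τ s m : ℝ}
    {z : (Fin n → EuclideanSpace ℝ (Fin d)) × (Fin n → ℝ)}
    {w : (Fin d → Fin d → ℝ) × (Fin d → ℝ)} (hκ : 0 ≤ κ) (hρ : 0 ≤ ρ) (hd : 0 < d)
    (hlam : 0 ≤ lam) (hS : S.PosSemidef) (hlamκ : lam ≤ κ * opNorm S) (hs : 0 ≤ s) (hs1 : s ≤ 1)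
    (hτ0 : 0 ≤ τ) (hm : m = lambdaMin S * s ^ 2 + lam) (hm0 : 0 < m) (hτm : 4 * √2 * τ ≤ m)
    (hz : ∀ i, ‖(dataset β z i).1‖ ≤ radius n S η ∧ |(dataset β z i).2| ≤ radius n S η * ‖β‖)
    (hM : ∀ x, m * (x ⬝ᵥ x) ≤ x ⬝ᵥ ridgeMatrix lam z.1 *ᵥ x)
    (hG : opNorm (Matrix.of w.1) ≤ 24 / 7 * √2 * τ)
    (hg : ‖WithLp.toLp 2 w.2‖ ≤ 4 * (τ * ‖β‖))
    (hE : ‖WithLp.toLp 2 ((ridgeMatrix lam z.1)⁻¹ *ᵥ errorMoment z)‖ ≤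
        5 * (ρ * (√(opNorm S) * ‖β‖) / √m)) :
    ‖dpRidge S β lam η (dataset β z) w - ridge lam (dataset β z)‖ ≤
      (7 * (14 + 25 * ρ) * (1 + κ)) *
        (τ * (opNorm S * ‖β‖) / (lambdaMin S ^ 2 * s ^ 4 + lam ^ 2)) := by
  have hmin0 := lambdaMin_nonneg hS
  have hp : 0 ≤ lambdaMin S * s ^ 2 := by positivity
  -- The smallness assumption on τ is used here: 24√2 τ/7 is 6/7 of 4√2 τ, which is at most `m`.
  have hGm : opNorm (Matrix.of w.1) ≤ 6 / 7 * m := by linarith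
  have hG' : opNorm (Matrix.of w.1) ≤ 5 * τ := by
    refine hG.trans (mul_le_mul_of_nonneg_right ?_ hτ0)
    nlinarith [Real.mul_self_sqrt (zero_le_two (α := ℝ)), Real.sqrt_nonneg (2 : ℝ)]
  have hdiff := norm_inv_add_mulVec_sub_le hm0 hM hGm (sampleCrossMoment (dataset β z)) w.2
  have hmΛ : m ≤ (1 + κ) * opNorm S := by
    have h1 := lambdaMin_le_opNorm hd hS.isHermitian
    have h2 : lambdaMin S * s ^ 2 ≤ lambdaMin S * 1 :=
      mul_le_mul_of_nonneg_left (pow_le_one₀ hs hs1) hmin0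
    linarith
  have e : lambdaMin S ^ 2 * s ^ 4 = (lambdaMin S * s ^ 2) ^ 2 := by ring
  have hq : lambdaMin S ^ 2 * s ^ 4 + lam ^ 2 ≤ m ^ 2 := by
    rw [hm, e]
    nlinarith [mul_nonneg hp hlam]
  have hq0 : 0 < lambdaMin S ^ 2 * s ^ 4 + lam ^ 2 := by
    have h2 : m ^ 2 ≤ 2 * ((lambdaMin S * s ^ 2) ^ 2 + lam ^ 2) := by
      rw [hm]
      nlinarith [sq_nonneg (lambdaMin S * s ^ 2 - lam)]
    rw [e]
    linarith [pow_pos hm0 2]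
  have hb := (norm_ridge_le hlam hm0 (by linarith) β z hM).trans (add_le_add le_rfl hE)
  refine le_trans ?_ (rate_le hτ0 hm0 hκ hρ (norm_nonneg β) hmΛ hb hq0 hq)
  have e1 : dpRidge S β lam η (dataset β z) w = WithLp.toLp 2
      ((ridgeMatrix lam z.1 + Matrix.of w.1)⁻¹ *ᵥ (sampleCrossMoment (dataset β z) + w.2)) := by
    rw [dpRidge, truncateData_eq_self hz]
    rfl
  have e2 : ridge lam (dataset β z) = WithLp.toLp 2
      ((ridgeMatrix lam z.1)⁻¹ *ᵥ sampleCrossMoment (dataset β z)) := rfl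
  rw [e1, e2]
  refine hdiff.trans ?_
  gcongr

/-- The estimation error is of the stated order on an event of probability at least `1 - 5 η`, if
`log (1 / η)` exceeds an absolute constant. -/
theorem exists_accuracy_good {d n : ℕ} {S : Matrix (Fin d) (Fin d) ℝ}
    (β : EuclideanSpace ℝ (Fin d)) {K κ ρ lam η μ σ : ℝ} {ν : Measure (EuclideanSpace ℝ (Fin d))}
    (hK : 0 < K) (hκ : 0 ≤ κ) (hρ : 0 ≤ ρ) (hd : 0 < d) (hn : 0 < n) (hlam : 0 ≤ lam)
    (hη0 : 0 < η) (hη1 : η < 1) (hμ : 0 < μ) (hσ : 0 ≤ σ) (hν : IsSubGaussian ν S K)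
    (htrunc : 1 - η ≤ (modelLaw n ν σ).real {z | ∀ i, ‖(dataset β z i).1‖ ≤ radius n S η ∧
      |(dataset β z i).2| ≤ radius n S η * ‖β‖})
    (hlamκ : lam ≤ κ * opNorm S)
    (hσρ : σ * √((d + Real.log (1 / η)) / n) ≤ ρ * (√(opNorm S) * ‖β‖))
    (hs : 0 ≤ shrink (6 * K ^ 2) d n η)
    (hτ : noiseOrder n S η μ ≤ 1 / (4 * √2) * (lambdaMin S * shrink (6 * K ^ 2) d n η ^ 2 + lam))
    (hlog : 40 ≤ Real.log (1 / η)) :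
    ∃ bad : Set (((Fin n → EuclideanSpace ℝ (Fin d)) × (Fin n → ℝ)) ×
        ((Fin d → Fin d → ℝ) × (Fin d → ℝ))),
      ((modelLaw n ν σ).prod (privacyNoise n S β η μ)) bad ≤ ENNReal.ofReal (5 * η) ∧
      ∀ p ∉ bad, ‖dpRidge S β lam η (dataset β p.1) p.2 - ridge lam (dataset β p.1)‖ ≤
        (7 * (14 + 25 * ρ) * (1 + κ)) * (noiseOrder n S η μ * (opNorm S * ‖β‖) /
          (lambdaMin S ^ 2 * shrink (6 * K ^ 2) d n η ^ 4 + lam ^ 2)) := by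
  have := hν.prob
  have hprob : IsProbabilityMeasure (modelLaw n ν σ) := by unfold modelLaw; infer_instance
  have hS := hν.posSemidef
  have hd' : (1 : ℝ) ≤ d := by exact_mod_cast hd
  have hn' : (0 : ℝ) < n := by exact_mod_cast hn
  have hR := radius_sq_pos hd hn hS hη0 hη1
  set s := shrink (6 * K ^ 2) d n η with hsdef
  set τ := noiseOrder n S η μ with hτdef
  set m := lambdaMin S * s ^ 2 + lam with hm
  set l := Real.log (1 / η) with hl
  set L := Real.log (2 * d / η) with hL
  have hlL : l ≤ L := by
    refine Real.log_le_log (by positivity) ?_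
    gcongr
    linarith
  have hσ1 : 0 < sigma₁ n S η μ := by unfold sigma₁; positivity
  have hσ2 : sigma₂ n S β η μ = sigma₁ n S η μ * ‖β‖ := by
    unfold sigma₁ sigma₂; ring
  have hdL : (d : ℝ) * 40 ≤ d * L := by gcongr; linarith
  have hdL' : l ≤ d * L := by nlinarith
  have hστ : sigma₁ n S η μ * √(d * L) = 2 * τ := noiseOrder_eq hd n S η μ
  have hτ0 : 0 < τ := by
    have : 0 < sigma₁ n S η μ * √(d * L) := mul_pos hσ1 (Real.sqrt_pos.2 (by nlinarith))
    linarith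
  have hs2 : 0 < √(2 : ℝ) := by positivity
  have hτm : 4 * √2 * τ ≤ m := by
    have := mul_le_mul_of_nonneg_left hτ (by positivity : 0 ≤ 4 * √(2 : ℝ))
    rwa [← mul_assoc, mul_one_div_cancel (by positivity), one_mul] at this
  have hm0 : 0 < m := lt_of_lt_of_le (by positivity) hτm
  have hmin0 := lambdaMin_nonneg hS
  have hlamm : lam ≤ m := by
    have : 0 ≤ lambdaMin S * s ^ 2 := by positivity
    linarith
  obtain ⟨goodA, hgoodAm, hgoodA, hgoodA'⟩ :=
    hν.exists_sampleSecondMoment_ge hK hd hn hη0 hη1 hs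
  have hcoer : ∀ A ∈ goodA, ∀ x, m * (x ⬝ᵥ x) ≤ x ⬝ᵥ ridgeMatrix lam A *ᵥ x := by
    intro A hA x
    have h := hgoodA' (fun i => (A i, 0)) hA x
    rw [ridgeMatrix, Matrix.add_mulVec, dotProduct_add, Matrix.smul_mulVec,
      Matrix.one_mulVec, dotProduct_smul, smul_eq_mul, hm, add_mul]
    linarith
  -- Here t²/2 = (9/8) dL. One dL covers log(1/η), and the remaining dL/8 covers 5d because L ≥ 40;
  -- this is where the threshold 40 comes from.
  set t := 3 / 2 * √(d * L) with ht
  have ht2 : 5 * d + l ≤ t ^ 2 / 2 := by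
    rw [ht, mul_pow, Real.sq_sqrt (by nlinarith)]
    linarith
  obtain ⟨goodW, hgoodWm, hgoodW, hgoodW'⟩ := exists_privacyNoise_good hd n S β (t := t) hη0 hσ1.le
    (by rw [hσ2]; positivity) (by positivity) ht2
  -- This finer level, without the factor d in front of the logarithm, matches the scale of the
  -- assumption on σ.
  set t' := √(10 * (d + l)) with ht'
  have ht'2 : 5 * d + l ≤ t' ^ 2 / 2 := by
    rw [ht', Real.sq_sqrt (by nlinarith)]
    linarith
  obtain ⟨badE, hbadEm, hbadE, hbadE'⟩ := exists_modelLaw_error_good hd hn hlam hm0 ν (t := t') hσ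
    hη0 (by positivity) ht'2 hgoodAm hcoer
  set goodT : Set ((Fin n → EuclideanSpace ℝ (Fin d)) × (Fin n → ℝ)) :=
    {z | ∀ i, ‖(dataset β z i).1‖ ≤ radius n S η ∧
      |(dataset β z i).2| ≤ radius n S η * ‖β‖} with hgoodT
  have hgoodTm : MeasurableSet goodT := by
    have : goodT = ⋂ i, ({z | ‖(dataset β z i).1‖ ≤ radius n S η} ∩
        {z | |(dataset β z i).2| ≤ radius n S η * ‖β‖}) := by
      ext z
      simp [hgoodT]
    rw [this]
    refine MeasurableSet.iInter fun i => ?_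
    unfold dataset
    exact (measurableSet_le (by fun_prop) measurable_const).inter
      (measurableSet_le (by fun_prop) measurable_const)
  have hgoodTc : modelLaw n ν σ goodTᶜ ≤ ENNReal.ofReal η := by
    rw [← ENNReal.ofReal_toReal (measure_ne_top (modelLaw n ν σ) goodTᶜ)]
    refine ENNReal.ofReal_le_ofReal ?_
    change (modelLaw n ν σ).real goodTᶜ ≤ η
    rw [probReal_compl_eq_one_sub hgoodTm]
    linarith
  have hgoodAc : modelLaw n ν σ (goodAᶜ ×ˢ Set.univ) ≤ ENNReal.ofReal η := by
    rw [modelLaw, Measure.prod_prod, measure_univ, mul_one]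
    exact hgoodA
  refine ⟨((goodTᶜ ∪ goodAᶜ ×ˢ Set.univ ∪ badE) ×ˢ Set.univ) ∪ (Set.univ ×ˢ goodWᶜ), ?_, ?_⟩
  · refine (measure_union_le _ _).trans ?_
    rw [Measure.prod_prod, Measure.prod_prod, measure_univ, measure_univ, mul_one, one_mul]
    have e : ENNReal.ofReal (5 * η) = ENNReal.ofReal η + ENNReal.ofReal η + ENNReal.ofReal η +
        ENNReal.ofReal (2 * η) := by
      rw [← ENNReal.ofReal_add, ← ENNReal.ofReal_add, ← ENNReal.ofReal_add]
      · congr 1; ring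
      all_goals positivity
    rw [e]
    refine add_le_add ((measure_union_le _ _).trans (add_le_add ?_ hbadE)) hgoodW
    exact (measure_union_le _ _).trans (add_le_add hgoodTc hgoodAc)
  · rintro ⟨z, w⟩ hp
    simp only [Set.mem_union, Set.mem_prod, Set.mem_compl_iff, Set.mem_univ, and_true, true_and,
      not_or, not_not] at hp
    obtain ⟨⟨⟨hzT, hzA⟩, hzE⟩, hw⟩ := hp
    obtain ⟨hG, hg⟩ := hgoodW' w hw
    have hs1 : s ≤ 1 := by
      have h0 : 0 ≤ 6 * K ^ 2 * (√(d / n) + √(Real.log (1 / η) / n)) := by positivity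
      have : s = 1 - 6 * K ^ 2 * (√(d / n) + √(Real.log (1 / η) / n)) := rfl
      linarith
    refine norm_dpRidge_sub_ridge_le hκ hρ hd hlam hS hlamκ hs hs1 hτ0.le hm hm0 hτm hzT
      (hcoer z.1 hzA) (hG.trans_eq ?_) (hg.trans ?_) ((hbadE' z hzA hzE).trans ?_)
    · rw [ht]
      linear_combination (8 / 7 * √2 * (3 / 2)) * hστ
    · have e : 16 / 15 * (sigma₂ n S β η μ * t) = 16 / 5 * (τ * ‖β‖) := by
        rw [hσ2, ht]
        linear_combination (16 / 15 * ‖β‖ * (3 / 2)) * hστ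
      rw [e]
      exact mul_le_mul_of_nonneg_right (by norm_num) (by positivity)
    · have e1 : σ / √(n * m) * t' = √10 * (σ * √((d + l) / n)) / √m := by
        rw [ht', Real.sqrt_mul hn'.le, Real.sqrt_mul (by norm_num), Real.sqrt_div (by linarith)]
        field_simp
      have h10 : √(10 : ℝ) ≤ 4 := Real.sqrt_le_iff.2 ⟨by norm_num, by norm_num⟩
      have h0 : 0 ≤ ρ * (√(opNorm S) * ‖β‖) := by positivity
      have h1 : √10 * (σ * √((d + l) / n)) ≤ 4 * (ρ * (√(opNorm S) * ‖β‖)) :=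
        mul_le_mul h10 hσρ (by positivity) (by norm_num)
      have h2 : √10 * (σ * √((d + l) / n)) / √m ≤ 4 * (ρ * (√(opNorm S) * ‖β‖)) / √m :=
        div_le_div_of_nonneg_right h1 (Real.sqrt_nonneg _)
      have h3 : 0 ≤ ρ * (√(opNorm S) * ‖β‖) / √m := by positivity
      rw [e1]
      rw [mul_div_assoc 4] at h2
      linarith

end DPRidge

end

open DPRidge
theorem theorem4p3 :
    -- Privacy: the output is `√2 μ`-GDP.
    (∀ (d n : ℕ) (S : Matrix (Fin d) (Fin d) ℝ) (β : EuclideanSpace ℝ (Fin d)) (lam η μ : ℝ),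
      0 < d → 0 < n → S.PosSemidef → 0 ≤ lam → 0 < η → η < 1 → 0 < μ →
      IsGDP (√2 * μ) (dpRidgeLaw (n := n) S β lam η μ)) ∧
    -- Accuracy: `c` and `c'` depend only on the sub-Gaussian constant `K`, and `C` only on `K`, on
    -- a bound `κ` for `lam / ‖S‖` and on a bound `ρ` for the relative size of the response errors.
    (∀ K : ℝ, 0 < K → ∃ c > (0 : ℝ), ∃ c' > (0 : ℝ), ∀ κ ρ : ℝ, 0 ≤ κ → 0 ≤ ρ → ∃ C > (0 : ℝ),
      ∀ (d n : ℕ) (S : Matrix (Fin d) (Fin d) ℝ) (β : EuclideanSpace ℝ (Fin d))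
        (lam η μ σ : ℝ) (ν : Measure (EuclideanSpace ℝ (Fin d))),
      0 < d → 0 < n → 0 ≤ lam → 0 < η → η < 1 → 0 < μ → 0 ≤ σ →
      IsSubGaussian ν S K →
      -- with probability at least `1 - η`, no sample is changed by the truncation
      1 - η ≤ (modelLaw n ν σ).real {z | ∀ i, ‖(dataset β z i).1‖ ≤ radius n S η ∧
        |(dataset β z i).2| ≤ radius n S η * ‖β‖} →
      lam ≤ κ * opNorm S →
      σ * √((d + Real.log (1 / η)) / n) ≤ ρ * (√(opNorm S) * ‖β‖) →
      0 ≤ shrink c d n η →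
      noiseOrder n S η μ ≤
        1 / (4 * √2) * (lambdaMin S * shrink c d n η ^ 2 + lam) →
      1 - c' * η ≤ ((modelLaw n ν σ).prod (privacyNoise n S β η μ)).real
        {p | ‖dpRidge S β lam η (dataset β p.1) p.2 - ridge lam (dataset β p.1)‖ ≤
          C * (noiseOrder n S η μ * (opNorm S * ‖β‖) /
            (lambdaMin S ^ 2 * shrink c d n η ^ 4 + lam ^ 2))}) := by
  refine ⟨fun d n S β lam η μ hd hn hS _ hη0 hη1 hμ => isGDP_dpRidgeLaw S β lam hd hn hS hη0 hη1 hμ,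
    fun K hK => ⟨6 * K ^ 2, by positivity, Real.exp 40, Real.exp_pos _, fun κ ρ hκ hρ =>
      ⟨7 * (14 + 25 * ρ) * (1 + κ), by positivity, ?_⟩⟩⟩
  intro d n S β lam η μ σ ν hd hn hlam hη0 hη1 hμ hσ hν htrunc hlamκ hσρ hs hτ
  -- The choice c' = e⁴⁰ makes the claim void unless log(1/η) > 40, and it exceeds the 5 lost in the
  -- union of bad events.
  rcases le_or_gt 1 (Real.exp 40 * η) with hη | hη
  · exact (sub_nonpos.2 hη).trans measureReal_nonneg
  have hlog : 40 ≤ Real.log (1 / η) := by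
    rw [Real.le_log_iff_exp_le (by positivity), le_div_iff₀ hη0]
    exact hη.le
  obtain ⟨bad, hbad, hgood⟩ := exists_accuracy_good β hK hκ hρ hd hn hlam hη0 hη1 hμ hσ hν htrunc
    hlamκ hσρ hs hτ hlog
  have := hν.prob
  have hprob : MeasureTheory.IsProbabilityMeasure (modelLaw n ν σ) := by
    unfold modelLaw; infer_instance
  set Q := (modelLaw n ν σ).prod (privacyNoise n S β η μ) with hQ
  have hbad' : Q.real bad ≤ 5 * η :=
    ENNReal.toReal_le_of_le_ofReal (by positivity) hbad
  have h40 : (5 : ℝ) ≤ Real.exp 40 := by linarith [Real.add_one_le_exp (40 : ℝ)]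
  have hcover : Q.real Set.univ ≤ Q.real bad + Q.real badᶜ := by
    rw [← Set.union_compl_self bad]
    exact MeasureTheory.measureReal_union_le _ _
  have huniv : Q.real Set.univ = 1 := by simp
  have h5 : 5 * η ≤ Real.exp 40 * η := by gcongr
  refine le_trans ?_ (MeasureTheory.measureReal_mono (μ := Q) (s₁ := badᶜ) hgood)
  linarith
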